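/- \textbf{Model.} A rooted causal triangulation of a strip $\mathcal S\times[j,j+1]$ ($\mathcal S$ the circle) is a cyclic arrangement of finitely many triangles, each an up-triangle (horizontal edge on the lower circle) or a down-triangle (horizontal edge on the upper circle), with at least one of each kind, and with a distinguished up-triangle, the root, from which the up-triangles and the down-triangles are numbered in cyclic order. A rooted causal dynamical triangulation with $N\ge 1$ strips and periodic boundary condition is a sequence $\underline{\mathbf t}=(\mathbf t(0),\dots,\mathbf t(N-1))$ of such strips (indices mod $N$) for which the number of down-triangles of $\mathbf t(i)$ equals the number of up-triangles of $\mathbf t(i+1)$ for all $i$; the $l$-th down-triangle of $\mathbf t(i)$ is glued to the $l$-th up-triangle of $\mathbf t(i+1)$. Let $n(\underline{\mathbf t})$ be the total number of triangles. Each triangle $t$ carries a spin $\sigma(t)=\pm1$, the energy is $\mathbf h(\sigma,\underline{\mathbf t})=-\sum\sigma(t)\sigma(t')$, summed over all edges of $\underline{\mathbf t}$ ($t,t'$ being the two triangles sharing the edge), and $$\Xi_N(\beta,\mu)=\sum_{\underline{\mathbf t}}e^{-\mu n(\underline{\mathbf t})}\sum_{\sigma}e^{-\beta\mathbf h(\sigma,\underline{\mathbf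 t})}\in(0,\infty],\qquad \phi_N(\beta,\mu)=\frac1N\ln\Xi_N(\beta,\mu),\qquad \phi(\beta,\mu)=\lim_{N\to\infty}\phi_N(\beta,\mu).$$ \textbf{Notation.} Put $$\Lambda(s)=\left[\frac{1-\sqrt{1-4e^{-2s}}}{2e^{-s}}\right]^2,\qquad c=\frac{e^{\beta-\mu}}{e^{2\beta}(1-e^{\beta-\mu})^2-e^{-2\mu}},\qquad m=e^{2\beta}+(1-e^{4\beta})e^{-(\beta+\mu)},$$ $$\lambda(\beta,\mu)=c^2(m^2+1)\cosh(2\beta)\left(1+\sqrt{1-\frac{1}{\cosh^2 2\beta}\,\frac{(m^2-1)^2}{(m^2+1)^2}}\right),\qquad \psi(\beta)=\inf\{\mu>0:\lambda(\beta,\mu)<1\}$$ (the infimum being over those $\mu$ for which the denominator of $c$ is non-zero), and $$f_1(\beta)=\max\{\ln 2,\tfrac32\ln(2\sinh\beta)\},\qquad f_2(\beta)=\min\{\psi(\beta)-\ln2,\ \tfrac32\beta+\ln2\},\qquad I(\beta)=[f_1(\beta),f_2(\beta)].$$ \textbf{Corollary 2.} Fix $\beta>0$. For every $\mu>f_2(\beta)+\ln2$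 the limit $\phi(\beta,\mu)$ exists and is finite, and $\mu\mapsto-\phi(\beta,\mu)$ is strictly increasing on $(f_2(\beta)+\ln 2,\infty)$. For every $\mu<f_1(\beta)+\ln2$ the limit $\phi(\beta,\mu)$ exists and equals $+\infty$. Moreover, $I(\beta)\to\{\ln2\}$ in the Hausdorff distance as $\beta\to0^+$, and for every $\mu>2\ln2$ one has $\phi(0^+,\mu)=\ln\Lambda(\mu-\ln2)$, both in the sense that $\phi_N(0^+,\mu)=\lim_{\beta\to0^+}\phi_N(\beta,\mu)$ exists for every $N\ge1$ and $\lim_{N\to\infty}\phi_N(0^+,\mu)=\ln\Lambda(\mu-\ln2)$, and in the sense that $\lim_{\beta\to0^+}\phi(\beta,\mu)=\ln\Lambda(\mu-\ln2)$. -/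

import Mathlib

open Filter Topology

namespace IsingCDT

/-- A rooted causal triangulation of one strip `S × [j, j+1]`.  Going once around the strip
anticlockwise, starting from the root face, one meets `n` triangles; triangle `k` is an
up-triangle (its horizontal edge lies on the lower circle `S × {j}`) if `isUp k = true`, and a
down-triangle (its horizontal edge lies on the upper circle `S × {j+1}`) otherwise.  The root face
is an up-triangle, and each of the two boundary circles carries at least one edge. -/
structure Strip where
  /-- number of triangles -/
  n : ℕ
  /-- type of each triangle -/
  isUp : Fin n → Bool
  root_up : ∃ h : 0 < n, isUp ⟨0, h⟩ = true
  exists_down : ∃ k, isUp k = false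

namespace Strip

/-- The up-triangles of the strip. -/
def ups (t : Strip) : Finset (Fin t.n) := Finset.univ.filter fun k => t.isUp k = true

/-- The down-triangles of the strip. -/
def downs (t : Strip) : Finset (Fin t.n) := Finset.univ.filter fun k => t.isUp k = false

/-- The number of up-triangles, i.e. of edges on the lower circle. -/
def nUp (t : Strip) : ℕ := t.ups.card

/-- The number of down-triangles, i.e. of edges on the upper circle. -/
def nDown (t : Strip) : ℕ := t.downs.card

/-- The `l`-th up-triangle, counted from the root face. -/
def up (t : Strip) (l : Fin t.nUp) : Fin t.n := t.ups.orderEmbOfFin rfl l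

/-- The `l`-th down-triangle, counted from the root face. -/
def down (t : Strip) (l : Fin t.nDown) : Fin t.n := t.downs.orderEmbOfFin rfl l

/-- Spin configurations on the triangles of a strip; the spins are `1` and `-1`. -/
abbrev Spins (t : Strip) : Type := Fin t.n → ℤˣ

/-- The inner energy `h(σ)` of a strip: consecutive triangles around the strip share an edge. -/
noncomputable def innerEnergy (t : Strip) (σ : t.Spins) : ℝ :=
  -∑ k : Fin t.n, (((σ k * σ (finRotate t.n k) : ℤˣ) : ℤ) : ℝ)

/-- The interaction energy `v(σ, τ)` of a strip `s` with the strip `t` glued on top of it: the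
`l`-th down-triangle of `s` and the `l`-th up-triangle of `t` share the `l`-th edge of the common
circle. -/
noncomputable def interEnergy (s t : Strip) (h : s.nDown = t.nUp) (σ : s.Spins) (τ : t.Spins) :
    ℝ :=
  -∑ l : Fin s.nDown, (((σ (s.down l) * τ (t.up (Fin.cast h l)) : ℤˣ) : ℤ) : ℝ)

end Strip

/-- Rooted causal dynamical triangulations with `N` strips and periodic boundary condition:
cyclically compatible sequences of strips (`finRotate N i` is `i + 1` modulo `N`). -/
structure CDT (N : ℕ) where
  /-- the strips -/
  strip : Fin N → Strip
  compat : ∀ i, (strip i).nDown = (strip (finRotate N i)).nUp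

namespace CDT

/-- The total number of triangles. -/
def size {N : ℕ} (t : CDT N) : ℕ := ∑ i, (t.strip i).n

/-- Spin configurations on all the triangles. -/
abbrev Spins {N : ℕ} (t : CDT N) : Type := ∀ i, (t.strip i).Spins

/-- The Ising partition function on a fixed triangulation at inverse temperature `β`. -/
noncomputable def isingZ {N : ℕ} (t : CDT N) (β : ℝ) : ℝ :=
  ∑ σ : t.Spins, ∏ i, Real.exp (-β * (t.strip i).innerEnergy (σ i)
    - β * (t.strip i).interEnergy (t.strip (finRotate N i)) (t.compat i)
        (σ i) (σ (finRotate N i)))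

end CDT

/-- The partition function `Ξ_N(β, μ)` of the `N`-strip annealed Ising model coupled to causal
dynamical triangulations, a sum of positive terms with value in `[0, ∞]`. -/
noncomputable def partitionFunction (N : ℕ) (β μ : ℝ) : ENNReal :=
  ∑' t : CDT N, ENNReal.ofReal (Real.exp (-μ * t.size) * t.isingZ β)

/-- The finite-volume free energy `φ_N(β, μ) = (1/N) ln Ξ_N(β, μ)`, with `ln ∞ = ∞`. -/
noncomputable def freeEnergyN (N : ℕ) (β μ : ℝ) : EReal :=
  ENNReal.log (partitionFunction N β μ) / (N : EReal)

/-- The infinite-volume free energy `φ(β, μ) = lim_N φ_N(β, μ)` (meaningful where the limit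
exists). -/
noncomputable def freeEnergy (β μ : ℝ) : EReal :=
  limUnder atTop fun N : ℕ => freeEnergyN N β μ

/-- The largest eigenvalue `Λ(s)` of the transfer matrix of pure causal triangulations. -/
noncomputable def Lam (s : ℝ) : ℝ :=
  ((1 - √(1 - 4 * Real.exp (-2 * s))) / (2 * Real.exp (-s))) ^ 2

/-- The denominator of `c(β, μ)`. -/
noncomputable def cDen (β μ : ℝ) : ℝ :=
  Real.exp (2 * β) * (1 - Real.exp (β - μ)) ^ 2 - Real.exp (-2 * μ)

/-- The coefficient `c(β, μ)`. -/
noncomputable def c (β μ : ℝ) : ℝ := Real.exp (β - μ) / cDen β μ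

/-- The coefficient `m(β, μ)`. -/
noncomputable def m (β μ : ℝ) : ℝ :=
  Real.exp (2 * β) + (1 - Real.exp (4 * β)) * Real.exp (-(β + μ))

/-- The function `λ(β, μ)`, defined where `cDen β μ ≠ 0`. -/
noncomputable def lam (β μ : ℝ) : ℝ :=
  c β μ ^ 2 * (m β μ ^ 2 + 1) * Real.cosh (2 * β) *
    (1 + √(1 - 1 / Real.cosh (2 * β) ^ 2 * ((m β μ ^ 2 - 1) ^ 2 / (m β μ ^ 2 + 1) ^ 2)))

/-- `ψ(β) = inf {μ > 0 : λ(β, μ) < 1}`, over the `μ` for which `λ(β, μ)` is defined. -/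
noncomputable def psi (β : ℝ) : ℝ := sInf {μ : ℝ | 0 < μ ∧ cDen β μ ≠ 0 ∧ lam β μ < 1}

/-- The lower end of the interval `I(β)`. -/
noncomputable def f₁ (β : ℝ) : ℝ := max (Real.log 2) (3 / 2 * Real.log (2 * Real.sinh β))

/-- The upper end of the interval `I(β)`. -/
noncomputable def f₂ (β : ℝ) : ℝ := min (psi β - Real.log 2) (3 / 2 * β + Real.log 2)

/-- The interval `I(β) = [f₁(β), f₂(β)]`. -/
noncomputable def I (β : ℝ) : Set ℝ := Set.Icc (f₁ β) (f₂ β)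

end IsingCDT

namespace IsingCDT

open scoped ENNReal

/-! ### Non-negative kernels: iterates, closed paths, Hilbert–Schmidt bounds. -/

section Kernel

/-! The partition function is a trace: summing over strips with spins, `Ξ_N` is the sum over closed
paths of length `N` of a positive kernel, `transfer`. The kernel is fixed only up to a gauge
parameter `γ`, which cancels around every loop but affects whether the kernel is Hilbert–Schmidt.

When it is, the limit exists and is finite (`exists_tendsto_log_loopSum`). Diagonal entries of the
iterates at a base strip are supermultiplicative, so Fekete's lemma gives a rate `L`. Loops avoiding
a large finite set of strips are exponentially negligible, by Cauchy–Schwarz; the others can be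
rotated to start in that set and compared with loops at the base strip, since any two strips are
joined by two steps. No spectral theory is used.

The two terms of `f₂` are two Hilbert–Schmidt criteria. With `γ = β`, bounding every spin product by
one gives pointwise domination by the kernel at `β = 0` and `μ - 3β/2`. With `γ = 0`, the squared
kernel is summed with `c` and `m` as resolvent entries of the 2×2 bond matrix; coupling two adjacent
strips leaves a matrix with an eigenvalue `λ`, and `λ < 1` makes a geometric series converge.

Divergence follows from two lower bounds on the Ising sum: its value at `β = 0` (as `exp x ≥ 1 + x`
and the mean energy vanishes) and its all-plus term. Both reduce to pure triangulations above the
critical fugacity `1/2`. Every triangulation has at least `2N` triangles, which gives strict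
monotonicity.

As `β → 0⁺` everything is squeezed by `Ξ_N(0, μ) ≤ Ξ_N(β, μ) ≤ Ξ_N(0, μ - 3β/2)`. The value at `β =
0` is explicit: the pure transfer operator preserves the functions `d ↦ α d z^d`, moving `z` by a
Möbius map whose attracting fixed point squared is `Λ`. -/

theorem ennreal_two_mul_le_add_sq (a b : ℝ≥0∞) : 2 * a * b ≤ a ^ 2 + b ^ 2 := by
  rcases eq_or_ne a ⊤ with rfl | ha
  · simp
  rcases eq_or_ne b ⊤ with rfl | hb
  · simp
  lift a to NNReal using ha
  lift b to NNReal using hb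
  exact_mod_cast two_mul_le_add_sq a b

/-- Cauchy–Schwarz by expanding the double sum and symmetrizing in `(i, j)`; this form needs no
finiteness assumption. -/
theorem sq_tsum_mul_le {ι : Type*} (a b : ι → ℝ≥0∞) :
    (∑' i, a i * b i) ^ 2 ≤ (∑' i, a i ^ 2) * ∑' i, b i ^ 2 := by
  have h2 : 2 * (∑' i, a i * b i) ^ 2 ≤ 2 * ((∑' i, a i ^ 2) * ∑' i, b i ^ 2) := by
    calc 2 * (∑' i, a i * b i) ^ 2
        = ∑' i, ∑' j, 2 * (a i * b j) * (a j * b i) := by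
          rw [sq, ← ENNReal.tsum_mul_right, ← ENNReal.tsum_mul_left]
          refine tsum_congr fun i => ?_
          rw [← ENNReal.tsum_mul_left, ← ENNReal.tsum_mul_left]
          exact tsum_congr fun j => by ring
      _ ≤ ∑' i, ∑' j, ((a i * b j) ^ 2 + (a j * b i) ^ 2) :=
          ENNReal.tsum_le_tsum fun i => ENNReal.tsum_le_tsum fun j =>
            ennreal_two_mul_le_add_sq _ _
      _ = 2 * ((∑' i, a i ^ 2) * ∑' i, b i ^ 2) := by
          simp_rw [ENNReal.tsum_add, mul_pow, ENNReal.tsum_mul_left, ENNReal.tsum_mul_right,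
            ENNReal.tsum_mul_left]
          ring
  exact (ENNReal.mul_le_mul_iff_right (by norm_num) (by norm_num)).1 h2

variable {X : Type*}

/-- The sum over closed paths of length `N` of the products of the kernel `K` along the path. -/
noncomputable def loopSum (K : X → X → ℝ≥0∞) (N : ℕ) : ℝ≥0∞ :=
  ∑' p : Fin N → X, ∏ i, K (p i) (p (finRotate N i))

open Classical in
/-- The iterates of a kernel. -/
noncomputable def kpow (K : X → X → ℝ≥0∞) : ℕ → X → X → ℝ≥0∞
  | 0 => fun x y => if x = y then 1 else 0
  | n + 1 => fun x y => ∑' z, K x z * kpow K n z y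

/-- The squared Hilbert–Schmidt norm of a kernel. -/
noncomputable def hsNorm (K : X → X → ℝ≥0∞) : ℝ≥0∞ := ∑' x, ∑' y, K x y ^ 2

theorem kpow_succ (K : X → X → ℝ≥0∞) (n : ℕ) (x y : X) :
    kpow K (n + 1) x y = ∑' z, K x z * kpow K n z y := rfl

theorem kpow_one (K : X → X → ℝ≥0∞) (x y : X) : kpow K 1 x y = K x y := by
  classical
  simp [kpow]

theorem kpow_add (K : X → X → ℝ≥0∞) (k n : ℕ) (x y : X) :
    kpow K (k + n) x y = ∑' z, kpow K k x z * kpow K n z y := by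
  classical
  induction k generalizing x with
  | zero => simp [kpow]
  | succ k ih =>
    rw [Nat.add_right_comm, kpow_succ]
    simp_rw [ih, kpow_succ, ← ENNReal.tsum_mul_left, ← ENNReal.tsum_mul_right]
    rw [ENNReal.tsum_comm]
    simp_rw [mul_assoc]

theorem kpow_mul_le (K : X → X → ℝ≥0∞) (k n : ℕ) (x y z : X) :
    kpow K k x z * kpow K n z y ≤ kpow K (k + n) x y := by
  rw [kpow_add]
  exact ENNReal.le_tsum z

/-- Cauchy–Schwarz in the intermediate point makes the norm submultiplicative. The exponent starts
at one because the zeroth iterate is the identity, whose norm is infinite on an infinite space. -/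
theorem hsNorm_kpow_le (K : X → X → ℝ≥0∞) (n : ℕ) :
    hsNorm (kpow K (n + 1)) ≤ hsNorm K ^ (n + 1) := by
  induction n with
  | zero => simp [hsNorm, kpow_one]
  | succ n ih =>
    calc hsNorm (kpow K (n + 1 + 1))
        ≤ ∑' x, ∑' y, (∑' z, K x z ^ 2) * ∑' z, kpow K (n + 1) z y ^ 2 :=
          ENNReal.tsum_le_tsum fun x => ENNReal.tsum_le_tsum fun y => by
            rw [kpow_succ]; exact sq_tsum_mul_le _ _
      _ = hsNorm K * hsNorm (kpow K (n + 1)) := by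
          simp_rw [ENNReal.tsum_mul_left, ENNReal.tsum_mul_right]
          rw [hsNorm, hsNorm, ENNReal.tsum_comm (f := fun x y => kpow K (n + 1) x y ^ 2)]
      _ ≤ hsNorm K * hsNorm K ^ (n + 1) := by gcongr
      _ = hsNorm K ^ (n + 1 + 1) := by ring

theorem tsum_fin_succ (n : ℕ) (f : (Fin (n + 1) → X) → ℝ≥0∞) :
    ∑' p, f p = ∑' x, ∑' q : Fin n → X, f (Fin.cons x q) := by
  rw [← (Fin.consEquiv (fun _ => X)).tsum_eq]
  exact ENNReal.tsum_prod (f := fun x (q : Fin n → X) => f (Fin.cons x q))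

theorem tsum_prod_fin (w : X → ℝ≥0∞) (N : ℕ) :
    ∑' p : Fin N → X, ∏ i, w (p i) = (∑' x, w x) ^ N := by
  induction N with
  | zero => simp
  | succ n ih =>
    rw [tsum_fin_succ]
    simp_rw [Fin.prod_univ_succ, Fin.cons_zero, Fin.cons_succ, ENNReal.tsum_mul_left, ih,
      ENNReal.tsum_mul_right]
    ring

theorem tsum_openPath (K : X → X → ℝ≥0∞) (n : ℕ) (x y : X) :
    ∑' q : Fin n → X, (∏ i : Fin n, K ((Fin.cons x q : Fin (n + 1) → X) i.castSucc) (q i)) *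
      K ((Fin.cons x q : Fin (n + 1) → X) (Fin.last n)) y = kpow K (n + 1) x y := by
  induction n generalizing x with
  | zero => simp [kpow_one]
  | succ n ih =>
    rw [tsum_fin_succ, kpow_succ]
    refine tsum_congr fun z => ?_
    rw [← ih z, ← ENNReal.tsum_mul_left]
    refine tsum_congr fun q => ?_
    rw [Fin.prod_univ_succ, ← Fin.succ_last]
    simp only [Fin.cons_succ, Fin.castSucc_zero, Fin.cons_zero, ← Fin.succ_castSucc]
    ring

theorem loop_prod_succ (K : X → X → ℝ≥0∞) (n : ℕ) (p : Fin (n + 1) → X) :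
    ∏ i, K (p i) (p (finRotate (n + 1) i)) =
      (∏ i : Fin n, K (p i.castSucc) (p i.succ)) * K (p (Fin.last n)) (p 0) := by
  rw [Fin.prod_univ_castSucc]
  simp only [finRotate_apply, Fin.coeSucc_eq_succ, Fin.last_add_one]

theorem tsum_loop_weight (K : X → X → ℝ≥0∞) (n : ℕ) (w : X → ℝ≥0∞) :
    ∑' p : Fin (n + 1) → X, w (p 0) * ∏ i, K (p i) (p (finRotate (n + 1) i)) =
      ∑' x, w x * kpow K (n + 1) x x := by
  rw [tsum_fin_succ]
  refine tsum_congr fun x => ?_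
  rw [← tsum_openPath, ← ENNReal.tsum_mul_left]
  refine tsum_congr fun q => ?_
  rw [loop_prod_succ]
  simp only [Fin.cons_succ, Fin.cons_zero]

/-- Loops have no preferred base point: rotating the indices by `j` moves the marked vertex to
position zero. -/
theorem tsum_loop_weight_at (K : X → X → ℝ≥0∞) (n : ℕ) (w : X → ℝ≥0∞) (j : Fin (n + 1)) :
    ∑' p : Fin (n + 1) → X, w (p j) * ∏ i, K (p i) (p (finRotate (n + 1) i)) =
      ∑' x, w x * kpow K (n + 1) x x := by
  rw [← tsum_loop_weight]
  rw [← (Equiv.arrowCongr (Equiv.addRight j) (Equiv.refl X)).tsum_eq]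
  refine tsum_congr fun p => ?_
  congr 1
  · simp [Equiv.arrowCongr]
  · refine Fintype.prod_equiv (Equiv.subRight j) _ _ fun i => ?_
    simp only [finRotate_apply, Equiv.arrowCongr, Equiv.coe_fn_mk, Function.comp,
      Equiv.coe_refl, id, Equiv.addRight_symm, Equiv.coe_addRight, Equiv.subRight_apply]
    congr 2 <;> abel

theorem loopSum_succ (K : X → X → ℝ≥0∞) (n : ℕ) :
    loopSum K (n + 1) = ∑' x, kpow K (n + 1) x x := by
  simpa [loopSum] using tsum_loop_weight K n fun _ => 1

/-- The trace of a product of two kernels is an inner product, so Cauchy–Schwarz applies. At least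
two factors are needed: a Hilbert–Schmidt kernel by itself may have infinite trace. -/
theorem sq_loopSum_le (K : X → X → ℝ≥0∞) (n : ℕ) :
    loopSum K (n + 2) ^ 2 ≤ hsNorm K ^ (n + 2) := by
  rw [loopSum_succ]
  simp_rw [kpow_succ K (n + 1)]
  rw [← ENNReal.tsum_prod (f := fun x z => K x z * kpow K (n + 1) z x)]
  refine (sq_tsum_mul_le _ _).trans ?_
  rw [ENNReal.tsum_prod (f := fun x z => K x z ^ 2),
    ENNReal.tsum_prod (f := fun x z => kpow K (n + 1) z x ^ 2), ENNReal.tsum_comm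
      (f := fun x z => kpow K (n + 1) z x ^ 2)]
  calc hsNorm K * hsNorm (kpow K (n + 1)) ≤ hsNorm K * hsNorm K ^ (n + 1) := by
        gcongr; exact hsNorm_kpow_le K n
    _ = hsNorm K ^ (n + 2) := by ring

theorem loopSum_mono {K K' : X → X → ℝ≥0∞} (h : ∀ x y, K x y ≤ K' x y) (N : ℕ) :
    loopSum K N ≤ loopSum K' N :=
  ENNReal.tsum_le_tsum fun _ => Finset.prod_le_prod' fun _ _ => h _ _

open Classical in
-- A loop either avoids `F` or visits it at one of its `n + 1` positions; in the second case a union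
-- bound and rotation make a point of `F` the base point.
theorem loopSum_le_add (K : X → X → ℝ≥0∞) (F : Finset X) (n : ℕ) :
    loopSum K (n + 1) ≤ loopSum (fun x y => if x ∈ F ∨ y ∈ F then 0 else K x y) (n + 1) +
      (n + 1) * ∑ x ∈ F, kpow K (n + 1) x x := by
  have key : ∀ p : Fin (n + 1) → X, ∏ i, K (p i) (p (finRotate (n + 1) i)) ≤
      (∏ i, if p i ∈ F ∨ p (finRotate (n + 1) i) ∈ F then 0 else
        K (p i) (p (finRotate (n + 1) i))) +
      ∑ j, (if p j ∈ F then 1 else 0) * ∏ i, K (p i) (p (finRotate (n + 1) i)) := by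
    intro p
    by_cases h : ∃ j, p j ∈ F
    · obtain ⟨j, hj⟩ := h
      refine le_add_left ?_
      refine le_trans ?_ (Finset.single_le_sum (fun _ _ => zero_le) (Finset.mem_univ j))
      simp [hj]
    · push Not at h
      refine le_add_right (le_of_eq ?_)
      simp [h]
  refine (ENNReal.tsum_le_tsum key).trans ?_
  rw [ENNReal.tsum_add]
  refine add_le_add le_rfl ?_
  rw [Summable.tsum_finsetSum fun _ _ => ENNReal.summable]
  simp_rw [tsum_loop_weight_at K n (fun x => if x ∈ F then 1 else 0)]
  rw [Finset.sum_const, Finset.card_univ, Fintype.card_fin, nsmul_eq_mul]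
  push_cast
  gcongr
  rw [tsum_eq_sum (s := F) (fun x hx => by simp [hx])]
  exact Finset.sum_le_sum fun x hx => by simp [hx]

open Classical in
theorem exists_finset_hsNorm_le (K : X → X → ℝ≥0∞) (hK : hsNorm K ≠ ⊤) {ε : ℝ≥0∞} (hε : 0 < ε) :
    ∃ F : Finset X, hsNorm (fun x y => if x ∈ F ∨ y ∈ F then 0 else K x y) ≤ ε := by
  have hK' : ∑' z : X × X, K z.1 z.2 ^ 2 ≠ ⊤ := by
    rwa [ENNReal.tsum_prod (f := fun x y => K x y ^ 2)]
  have := (ENNReal.tendsto_tsum_compl_atTop_zero hK').eventually (gt_mem_nhds hε)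
  obtain ⟨S, hS⟩ := this.exists
  refine ⟨S.image Prod.fst, le_trans ?_ hS.le⟩
  rw [hsNorm, ← ENNReal.tsum_prod
    (f := fun x y => (if x ∈ S.image Prod.fst ∨ y ∈ S.image Prod.fst then 0 else K x y) ^ 2)]
  rw [show (∑' b : {z : X × X // z ∉ S}, K (b : X × X).1 (b : X × X).2 ^ 2) =
    ∑' z : X × X, Set.indicator {z | z ∉ S} (fun z => K z.1 z.2 ^ 2) z from
      tsum_subtype {z : X × X | z ∉ S} (fun z => K z.1 z.2 ^ 2)]
  refine ENNReal.tsum_le_tsum fun z => ?_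
  split_ifs with h
  · simp
  · have : z ∉ S := fun hz => h (Or.inl (Finset.mem_image_of_mem _ hz))
    simp [this]

end Kernel

/-! ### Exponential growth rate of closed-path sums. -/

section KernelLimit

variable {X : Type*}

theorem kpow_le_loopSum (K : X → X → ℝ≥0∞) (n : ℕ) (x : X) :
    kpow K (n + 1) x x ≤ loopSum K (n + 1) := by
  rw [loopSum_succ]
  exact ENNReal.le_tsum x

theorem kpow_pow_le (K : X → X → ℝ≥0∞) (n : ℕ) (x : X) :
    K x x ^ n ≤ kpow K n x x := by
  induction n with
  | zero => simp [kpow]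
  | succ n ih =>
    rw [pow_succ']
    calc K x x * K x x ^ n ≤ kpow K 1 x x * kpow K n x x := by
          rw [kpow_one]; gcongr
      _ ≤ kpow K (n + 1) x x := by rw [add_comm]; exact kpow_mul_le K 1 n x x x

theorem kpow_ne_top (K : X → X → ℝ≥0∞) (h : hsNorm K ≠ ⊤) (n : ℕ) (x y : X) :
    kpow K (n + 1) x y ≠ ⊤ := by
  intro hx
  have h1 : kpow K (n + 1) x y ^ 2 ≤ hsNorm (kpow K (n + 1)) :=
    (ENNReal.le_tsum y).trans (ENNReal.le_tsum (f := fun x => ∑' y, kpow K (n + 1) x y ^ 2) x)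
  have := h1.trans (hsNorm_kpow_le K n)
  rw [hx] at this
  simp [h] at this

theorem sq_kpow_le (K : X → X → ℝ≥0∞) (n : ℕ) (x y : X) :
    kpow K (n + 1) x y ^ 2 ≤ hsNorm K ^ (n + 1) :=
  ((ENNReal.le_tsum y).trans
    (ENNReal.le_tsum (f := fun x => ∑' y, kpow K (n + 1) x y ^ 2) x)).trans (hsNorm_kpow_le K n)

/-- Fekete's lemma: keeping only `x₀` as intermediate point makes minus the logarithm subadditive,
and the Hilbert–Schmidt bound on entries keeps its quotient by `n` bounded below. -/
theorem exists_tendsto_log_kpow (K : X → X → ℝ≥0∞) (x₀ : X) (hK : hsNorm K ≠ ⊤)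
    (h0 : K x₀ x₀ ≠ 0) :
    ∃ L : ℝ, Tendsto (fun n : ℕ => Real.log (kpow K n x₀ x₀).toReal / n) atTop (𝓝 L) := by
  have hpos : ∀ n, kpow K n x₀ x₀ ≠ 0 := fun n h => by
    have := kpow_pow_le K n x₀
    rw [h] at this
    exact pow_ne_zero n h0 (le_antisymm this zero_le)
  have htop : ∀ n, kpow K n x₀ x₀ ≠ ⊤ := by
    rintro (_ | n)
    · simp [kpow]
    · exact kpow_ne_top K hK n x₀ x₀
  have hrpos : ∀ n, 0 < (kpow K n x₀ x₀).toReal := fun n =>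
    ENNReal.toReal_pos (hpos n) (htop n)
  have hsub : Subadditive fun n => -Real.log (kpow K n x₀ x₀).toReal := by
    intro k n
    have h := ENNReal.toReal_mono (htop _) (kpow_mul_le K k n x₀ x₀ x₀)
    rw [ENNReal.toReal_mul] at h
    have := Real.log_le_log (mul_pos (hrpos k) (hrpos n)) h
    rw [Real.log_mul (hrpos k).ne' (hrpos n).ne'] at this
    linarith
  have hh : 0 < (hsNorm K).toReal := by
    refine ENNReal.toReal_pos (fun h => h0 ?_) hK
    have := sq_kpow_le K 0 x₀ x₀
    rw [h, kpow_one] at this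
    simpa using this
  have hbdd : BddBelow (Set.range fun n : ℕ => -Real.log (kpow K n x₀ x₀).toReal / n) := by
    refine ⟨-|Real.log (hsNorm K).toReal|, ?_⟩
    rintro _ ⟨n, rfl⟩
    rcases n with _ | n
    · simp
    have h1 := sq_kpow_le K n x₀ x₀
    have h2 := ENNReal.toReal_mono (ENNReal.pow_ne_top hK) h1
    rw [ENNReal.toReal_pow, ENNReal.toReal_pow] at h2
    have h3 := Real.log_le_log (pow_pos (hrpos (n + 1)) 2) h2
    rw [Real.log_pow, Real.log_pow] at h3
    have hn : (0 : ℝ) < ((n + 1 : ℕ) : ℝ) := by positivity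
    rw [le_div_iff₀ hn]
    have h4 := mul_le_mul_of_nonneg_left (le_abs_self (Real.log (hsNorm K).toReal)) hn.le
    have h5 := mul_nonneg hn.le (abs_nonneg (Real.log (hsNorm K).toReal))
    push_cast at *
    nlinarith
  refine ⟨-hsub.lim, ?_⟩
  have := (hsub.tendsto_lim hbdd).neg
  refine this.congr fun n => ?_
  rw [neg_div, neg_neg]

/-- For a primitive Hilbert–Schmidt kernel, the exponential growth rate of the sums over closed
paths exists and is that of the diagonal entries of the iterates. -/
theorem exists_tendsto_log_loopSum (K : X → X → ℝ≥0∞) (x₀ : X) (hK : hsNorm K ≠ ⊤)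
    (h0 : K x₀ x₀ ≠ 0) (hto : ∀ x, kpow K 2 x₀ x ≠ 0) (hfrom : ∀ x, kpow K 2 x x₀ ≠ 0) :
    ∃ L : ℝ, Tendsto (fun n : ℕ => Real.log (kpow K n x₀ x₀).toReal / n) atTop (𝓝 L) ∧
      Tendsto (fun n : ℕ => ENNReal.log (loopSum K n) / (n : EReal)) atTop (𝓝 (L : EReal)) := by
  classical
  obtain ⟨L, hL⟩ := exists_tendsto_log_kpow K x₀ hK h0
  refine ⟨L, hL, ?_⟩
  set a : ℕ → ℝ := fun n => (kpow K n x₀ x₀).toReal with ha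
  have hpos : ∀ n, kpow K n x₀ x₀ ≠ 0 := fun n h => by
    have := kpow_pow_le K n x₀
    rw [h] at this
    exact pow_ne_zero n h0 (le_antisymm this zero_le)
  have htop : ∀ n, kpow K n x₀ x₀ ≠ ⊤ := by
    rintro (_ | n)
    · simp [kpow]
    · exact kpow_ne_top K hK n x₀ x₀
  have hapos : ∀ n, 0 < a n := fun n => ENNReal.toReal_pos (hpos n) (htop n)
  have hltop : ∀ n, loopSum K (n + 2) ≠ ⊤ := fun n h => by
    have := sq_loopSum_le K n
    rw [h] at this
    simp [hK] at this
  -- choose the finite set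
  set ε : ℝ := Real.exp (L - 1) with hε
  have hεpos : 0 < ε := Real.exp_pos _
  obtain ⟨F, hF⟩ := exists_finset_hsNorm_le K hK
    (ε := ENNReal.ofReal (ε ^ 2)) (by simp [hεpos])
  set K' : X → X → ℝ≥0∞ := fun x y => if x ∈ F ∨ y ∈ F then 0 else K x y with hK'
  have htail : ∀ n, loopSum K' (n + 2) ≤ ENNReal.ofReal (ε ^ (n + 2)) := by
    intro n
    have h1 : loopSum K' (n + 2) ^ 2 ≤ ENNReal.ofReal (ε ^ (n + 2)) ^ 2 := by
      refine (sq_loopSum_le K' n).trans ?_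
      calc hsNorm K' ^ (n + 2) ≤ ENNReal.ofReal (ε ^ 2) ^ (n + 2) := by gcongr
        _ = ENNReal.ofReal (ε ^ (n + 2)) ^ 2 := by
          rw [← ENNReal.ofReal_pow (by positivity), ← ENNReal.ofReal_pow (by positivity)]
          congr 1; ring
    exact (ENNReal.pow_le_pow_left_iff (by norm_num)).1 h1
  -- A loop at `x ∈ F` becomes a loop at `x₀` by travelling there and back in two steps each way:
  -- four extra steps, at a cost depending only on `x`.
  have hF2 : ∀ n, ∑ x ∈ F, kpow K (n + 1) x x ≤
      (∑ x ∈ F, (kpow K 2 x₀ x * kpow K 2 x x₀)⁻¹) * kpow K (n + 5) x₀ x₀ := by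
    intro n
    rw [Finset.sum_mul]
    refine Finset.sum_le_sum fun x _ => ?_
    have hne : kpow K 2 x₀ x * kpow K 2 x x₀ ≠ 0 := mul_ne_zero (hto x) (hfrom x)
    have hnt : kpow K 2 x₀ x * kpow K 2 x x₀ ≠ ⊤ :=
      ENNReal.mul_ne_top (kpow_ne_top K hK 1 _ _) (kpow_ne_top K hK 1 _ _)
    rw [← ENNReal.div_eq_inv_mul, ENNReal.le_div_iff_mul_le (Or.inl hne) (Or.inl hnt)]
    calc kpow K (n + 1) x x * (kpow K 2 x₀ x * kpow K 2 x x₀)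
        = kpow K 2 x₀ x * (kpow K (n + 1) x x * kpow K 2 x x₀) := by ring
      _ ≤ kpow K 2 x₀ x * kpow K (n + 1 + 2) x x₀ := by gcongr; exact kpow_mul_le ..
      _ ≤ kpow K (2 + (n + 1 + 2)) x₀ x₀ := kpow_mul_le ..
      _ = kpow K (n + 5) x₀ x₀ := by congr 1; ring
  set C : ℝ≥0∞ := ∑ x ∈ F, (kpow K 2 x₀ x * kpow K 2 x x₀)⁻¹ with hC
  have hCtop : C ≠ ⊤ := by
    refine ENNReal.sum_ne_top.2 fun x _ => ?_
    exact ENNReal.inv_ne_top.2 (mul_ne_zero (hto x) (hfrom x))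
  have hupper : ∀ n : ℕ, (loopSum K (n + 2)).toReal ≤
      ε ^ (n + 2) + (n + 2) * (C.toReal * a (n + 6)) := by
    intro n
    have h1 : loopSum K (n + 2) ≤ ENNReal.ofReal (ε ^ (n + 2)) +
        (n + 2) * (C * kpow K (n + 6) x₀ x₀) := by
      refine (loopSum_le_add K F (n + 1)).trans (add_le_add (htail n) ?_)
      push_cast
      rw [add_assoc, one_add_one_eq_two]
      gcongr
      exact hF2 (n + 1)
    have ht : (n + 2 : ℝ≥0∞) * (C * kpow K (n + 6) x₀ x₀) ≠ ⊤ :=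
      ENNReal.mul_ne_top (by simp) (ENNReal.mul_ne_top hCtop (htop _))
    have h2 := ENNReal.toReal_mono (ENNReal.add_ne_top.2 ⟨ENNReal.ofReal_ne_top, ht⟩) h1
    rw [ENNReal.toReal_add ENNReal.ofReal_ne_top ht, ENNReal.toReal_ofReal (by positivity),
      ENNReal.toReal_mul, ENNReal.toReal_mul] at h2
    have h3 : ((n + 2 : ℝ≥0∞)).toReal = (n : ℝ) + 2 := by
      have : (n + 2 : ℝ≥0∞) = ((n + 2 : ℕ) : ℝ≥0∞) := by push_cast; rfl
      rw [this, ENNReal.toReal_natCast]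
      push_cast
      rfl
    rwa [h3] at h2
  have hlower : ∀ n, a (n + 2) ≤ (loopSum K (n + 2)).toReal := fun n =>
    ENNReal.toReal_mono (hltop n) (kpow_le_loopSum K (n + 1) x₀)
  -- shift of the limit
  have hL4 : Tendsto (fun n : ℕ => Real.log (a (n + 4)) / n) atTop (𝓝 L) := by
    have h1 := (hL.comp (tendsto_add_atTop_nat 4))
    have h2 : Tendsto (fun n : ℕ => ((n + 4 : ℕ) : ℝ) / n) atTop (𝓝 1) := by
      have : Tendsto (fun n : ℕ => 1 + (4 : ℝ) / n) atTop (𝓝 (1 + 0)) :=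
        tendsto_const_nhds.add (tendsto_const_div_atTop_nhds_zero_nat 4)
      rw [add_zero] at this
      refine this.congr' ?_
      filter_upwards [eventually_gt_atTop 0] with n hn
      have : (n : ℝ) ≠ 0 := by positivity
      push_cast
      field_simp
    have h3 := h1.mul h2
    rw [mul_one] at h3
    refine h3.congr' ?_
    filter_upwards [eventually_gt_atTop 0] with n hn
    have h4 : (n : ℝ) ≠ 0 := by positivity
    have h5 : ((n + 4 : ℕ) : ℝ) ≠ 0 := by positivity
    simp only [Function.comp, ha]
    field_simp
  -- This is the purpose of `ε = exp (L - 1)`: loops avoiding `F` grow at rate at most `L - 1`,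
  -- strictly below that of the diagonal entries.
  have hεa : ∀ᶠ n : ℕ in atTop, ε ^ n ≤ a (n + 4) := by
    have := hL4.eventually (lt_mem_nhds (show L - 1 < L by linarith))
    filter_upwards [this, eventually_gt_atTop 0] with n hn hn0
    have hn' : (0 : ℝ) < n := by positivity
    rw [lt_div_iff₀ hn'] at hn
    rw [← Real.log_le_log_iff (by positivity) (hapos _), Real.log_pow, hε, Real.log_exp]
    linarith
  set D : ℝ := 1 + C.toReal with hD
  have hDpos : 0 < D := by positivity
  have hbound : ∀ᶠ n : ℕ in atTop, (loopSum K n).toReal ≤ n * (D * a (n + 4)) := by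
    filter_upwards [hεa, eventually_ge_atTop 2] with n h1 h2
    obtain ⟨k, rfl⟩ := Nat.exists_eq_add_of_le' h2
    refine (hupper k).trans ?_
    have h3 : (1 : ℝ) * a (k + 6) ≤ ((k + 2 : ℕ) : ℝ) * a (k + 6) := by
      have := hapos (k + 6)
      gcongr
      push_cast
      have : (0 : ℝ) ≤ k := by positivity
      linarith
    have h4 : k + 2 + 4 = k + 6 := by ring
    rw [h4] at h1 ⊢
    rw [hD]
    push_cast at h3 ⊢
    nlinarith
  have hreal : Tendsto (fun n : ℕ => Real.log (loopSum K n).toReal / n) atTop (𝓝 L) := by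
    have hup : Tendsto (fun n : ℕ => (Real.log n / n + Real.log D / n) +
        Real.log (a (n + 4)) / n) atTop (𝓝 L) := by
      have h1 : Tendsto (fun n : ℕ => Real.log n / n) atTop (𝓝 0) := by
        have := Real.isLittleO_log_id_atTop.tendsto_div_nhds_zero
        exact this.comp tendsto_natCast_atTop_atTop
      have h2 := (h1.add (tendsto_const_div_atTop_nhds_zero_nat (Real.log D))).add hL4
      simpa using h2
    refine tendsto_of_tendsto_of_tendsto_of_le_of_le' hL hup ?_ ?_
    · filter_upwards [eventually_ge_atTop 2] with n hn
      obtain ⟨k, rfl⟩ := Nat.exists_eq_add_of_le' hn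
      have := Real.log_le_log (hapos _) (hlower k)
      gcongr
    · filter_upwards [hbound, eventually_ge_atTop 2] with n h1 hn
      have hn0 : (0 : ℝ) < n := by positivity
      have hlp : 0 < (loopSum K n).toReal := by
        obtain ⟨k, rfl⟩ := Nat.exists_eq_add_of_le' hn
        exact (hapos _).trans_le (hlower k)
      have := Real.log_le_log hlp h1
      rw [Real.log_mul hn0.ne' (mul_pos hDpos (hapos _)).ne',
        Real.log_mul hDpos.ne' (hapos _).ne'] at this
      rw [← add_div, ← add_div]
      gcongr
      linarith
  have hE : Tendsto (fun n : ℕ => ((Real.log (loopSum K n).toReal / n : ℝ) : EReal)) atTop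
      (𝓝 (L : EReal)) := (continuous_coe_real_ereal.tendsto L).comp hreal
  refine hE.congr' ?_
  filter_upwards [eventually_ge_atTop 2] with n hn
  obtain ⟨k, rfl⟩ := Nat.exists_eq_add_of_le' hn
  have hlp : 0 < (loopSum K (k + 2)).toReal := (hapos _).trans_le (hlower k)
  rw [ENNReal.log_pos_real' hlp, EReal.coe_div]
  rfl

end KernelLimit

/-! ### The transfer kernel and the partition function as a trace. -/

/-- Strips together with a spin configuration. -/
abbrev SpinStrip : Type := Σ t : Strip, t.Spins

namespace SpinStrip

/-- The inner energy of a strip with spins. -/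
noncomputable def inner (x : SpinStrip) : ℝ := x.1.innerEnergy x.2

end SpinStrip

open Classical in
/-- The interaction energy, extended by zero to incompatible pairs. -/
noncomputable def interaction (x y : SpinStrip) : ℝ :=
  if h : x.1.nDown = y.1.nUp then x.1.interEnergy y.1 h x.2 y.2 else 0

open Classical in
/-- The symmetrized transfer kernel, up to a gauge transformation with parameter `γ`. -/
noncomputable def transfer (β μ γ : ℝ) (x y : SpinStrip) : ℝ≥0∞ :=
  if x.1.nDown = y.1.nUp then ENNReal.ofReal (Real.exp (-μ / 2 * (x.1.n + y.1.n)
    - β / 2 * (x.inner + y.inner) - β * interaction x y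
    + γ / 4 * ((x.1.nUp - x.1.nDown : ℝ) - (y.1.nUp - y.1.nDown)))) else 0

theorem sum_finRotate {N : ℕ} {M : Type*} [AddCommMonoid M] (f : Fin N → M) :
    ∑ i, f (finRotate N i) = ∑ i, f i := Equiv.sum_comp (finRotate N) f

/-- Compatible sequences of strips. -/
def cdtEquiv (N : ℕ) :
    CDT N ≃ {p : Fin N → Strip // ∀ i, (p i).nDown = (p (finRotate N i)).nUp} where
  toFun t := ⟨t.strip, t.compat⟩
  invFun p := ⟨p.1, p.2⟩
  left_inv _ := rfl
  right_inv _ := rfl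

/-- Sequences of strips with spins. -/
def spinStripSeqEquiv (N : ℕ) :
    (Σ p : Fin N → Strip, ∀ i, (p i).Spins) ≃ (Fin N → SpinStrip) where
  toFun q i := ⟨q.1 i, q.2 i⟩
  invFun q := ⟨fun i => (q i).1, fun i => (q i).2⟩
  left_inv _ := rfl
  right_inv _ := rfl

theorem prod_transfer {N : ℕ} (β μ γ : ℝ) (q : Fin N → SpinStrip)
    (h : ∀ i, (q i).1.nDown = (q (finRotate N i)).1.nUp) :
    ∏ i, transfer β μ γ (q i) (q (finRotate N i)) =
      ENNReal.ofReal (Real.exp (-μ * ∑ i, ((q i).1.n : ℝ) +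
        ∑ i, (-β * (q i).1.innerEnergy (q i).2
          - β * (q i).1.interEnergy (q (finRotate N i)).1 (h i) (q i).2 (q (finRotate N i)).2))) := by
  simp only [transfer, if_pos (h _)]
  rw [← ENNReal.ofReal_prod_of_nonneg fun _ _ => (Real.exp_pos _).le, ← Real.exp_sum]
  congr 2
  simp only [interaction, dif_pos (h _), SpinStrip.inner]
  simp only [Finset.sum_add_distrib, Finset.sum_sub_distrib, ← Finset.mul_sum]
  rw [sum_finRotate fun i => ((q i).1.n : ℝ), sum_finRotate fun i => ((q i).1.nUp : ℝ),
    sum_finRotate fun i => ((q i).1.nDown : ℝ),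
    sum_finRotate fun i => (q i).1.innerEnergy (q i).2]
  ring

/-- Each strip's own weight is split into halves between its two neighbours, and the `γ` terms
telescope around the cycle. Incompatible sequences contribute zero, so exactly the triangulations
with spins remain. -/
theorem loopSum_transfer (N : ℕ) (β μ γ : ℝ) :
    loopSum (transfer β μ γ) N = partitionFunction N β μ := by
  classical
  rw [loopSum, partitionFunction, ← (spinStripSeqEquiv N).tsum_eq, ENNReal.tsum_sigma',
    ← (cdtEquiv N).symm.tsum_eq]
  rw [show (∑' c : {p : Fin N → Strip // ∀ i, (p i).nDown = (p (finRotate N i)).nUp},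
      ENNReal.ofReal (Real.exp (-μ * ((cdtEquiv N).symm c).size) *
        ((cdtEquiv N).symm c).isingZ β)) =
      ∑' c : {p : Fin N → Strip // ∀ i, (p i).nDown = (p (finRotate N i)).nUp},
        ∑' σ : (∀ i, (c.1 i).Spins), ∏ i, transfer β μ γ
          (⟨c.1 i, σ i⟩ : SpinStrip) ⟨c.1 (finRotate N i), σ (finRotate N i)⟩ from ?_]
  · refine Eq.trans ?_
      (tsum_subtype {p : Fin N → Strip | ∀ i, (p i).nDown = (p (finRotate N i)).nUp}
        fun p => ∑' σ : (∀ i, (p i).Spins), ∏ i, transfer β μ γ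
          (⟨p i, σ i⟩ : SpinStrip) ⟨p (finRotate N i), σ (finRotate N i)⟩).symm
    refine tsum_congr fun p => ?_
    by_cases hp : ∀ i, (p i).nDown = (p (finRotate N i)).nUp
    · rw [Set.indicator_of_mem (by exact hp)]
      rfl
    · rw [Set.indicator_of_notMem (by exact hp)]
      push Not at hp
      obtain ⟨i, hi⟩ := hp
      refine ENNReal.tsum_eq_zero.2 fun σ => ?_
      refine Finset.prod_eq_zero (Finset.mem_univ i) ?_
      exact if_neg hi
  · refine tsum_congr fun c => ?_
    rw [tsum_fintype, CDT.isingZ, Finset.mul_sum,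
      ENNReal.ofReal_sum_of_nonneg fun σ _ =>
        mul_nonneg (Real.exp_pos _).le (Finset.prod_nonneg fun _ _ => (Real.exp_pos _).le)]
    refine Finset.sum_congr rfl fun σ _ => ?_
    rw [prod_transfer β μ γ (fun i => (⟨c.1 i, σ i⟩ : SpinStrip)) c.2, ← Real.exp_sum,
      ← Real.exp_add]
    congr 3
    simp [CDT.size, cdtEquiv]

/-! ### Counting strips and the critical fugacity. -/

namespace Strip

theorem nUp_add_nDown (t : Strip) : t.nUp + t.nDown = t.n := by
  have h := Finset.card_filter_add_card_filter_not (s := (Finset.univ : Finset (Fin t.n)))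
    (fun k => t.isUp k = true)
  simp only [Bool.not_eq_true, Finset.card_univ, Fintype.card_fin] at h
  exact h

theorem nUp_pos (t : Strip) : 0 < t.nUp := by
  obtain ⟨h, h0⟩ := t.root_up
  exact Finset.card_pos.2 ⟨⟨0, h⟩, by simp [ups, h0]⟩

theorem nDown_pos (t : Strip) : 0 < t.nDown := by
  obtain ⟨k, h0⟩ := t.exists_down
  exact Finset.card_pos.2 ⟨k, by simp [downs, h0]⟩

/-- The strip in which the root is followed by triangles of the given types. -/
def ofTail {k : ℕ} (f : Fin k → Bool) (h : ∃ j, f j = false) : Strip where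
  n := k + 1
  isUp := Fin.cons true f
  root_up := ⟨Nat.succ_pos k, rfl⟩
  exists_down := h.imp' Fin.succ fun j hj => by simpa using hj

/-- Strips are determined by the types of the triangles after the root. -/
noncomputable def tailEquiv :
    {z : Σ k, Fin k → Bool // ∃ j, z.2 j = false} ≃ Strip :=
  Equiv.ofBijective (fun z => ofTail z.1.2 z.2) <| by
    constructor
    · rintro ⟨⟨k, f⟩, hf⟩ ⟨⟨l, g⟩, hg⟩ h
      simp only [ofTail, Strip.mk.injEq, Nat.add_right_cancel_iff] at h
      obtain ⟨rfl, h⟩ := h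
      simp only [heq_eq_eq, Fin.cons_inj, true_and] at h
      subst h
      rfl
    · rintro ⟨n, f, ⟨h, h0⟩, hd⟩
      obtain ⟨k, rfl⟩ := Nat.exists_eq_succ_of_ne_zero h.ne'
      have hcons : Fin.cons true (Fin.tail f) = f := by
        rw [show true = f 0 from h0.symm, Fin.cons_self_tail]
      refine ⟨⟨⟨k, Fin.tail f⟩, ?_⟩, ?_⟩
      · obtain ⟨j, hj⟩ := hd
        rcases Fin.eq_zero_or_eq_succ j with rfl | ⟨i, rfl⟩
        · exact absurd (h0.symm.trans hj) (by simp)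
        · exact ⟨i, hj⟩
      · simp only [ofTail, hcons]

theorem nDown_ofTail {k : ℕ} (f : Fin k → Bool) (h : ∃ j, f j = false) :
    (ofTail f h).nDown = (Finset.univ.filter fun j => f j = false).card := by
  unfold nDown downs ofTail
  rw [Fin.card_filter_univ_succ]
  simp

theorem tsum_strip_tail (F : Strip → ℝ≥0∞) :
    ∑' s, F s = ∑' k, ∑ f : Fin k → Bool, if h : ∃ j, f j = false then F (ofTail f h) else 0 := by
  rw [← tailEquiv.tsum_eq]
  have h1 := tsum_subtype {z : Σ k, Fin k → Bool | ∃ j, z.2 j = false}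
    (fun z => if h : ∃ j, z.2 j = false then F (ofTail z.2 h) else 0)
  refine Eq.trans (tsum_congr fun z => ?_) (h1.trans ?_)
  · rw [dif_pos z.2]
    rfl
  · rw [ENNReal.tsum_sigma']
    refine tsum_congr fun k => ?_
    rw [tsum_fintype]
    refine Finset.sum_congr rfl fun f _ => ?_
    by_cases h : ∃ j, f j = false
    · rw [Set.indicator_of_mem (by exact h)]
    · rw [Set.indicator_of_notMem (by exact h), dif_neg h]

theorem sum_bool_fun (k : ℕ) (G : ℕ → ℝ≥0∞) :
    ∑ f : Fin k → Bool, G (Finset.univ.filter fun j => f j = false).card =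
      ∑ j ∈ Finset.range (k + 1), (k.choose j : ℝ≥0∞) * G j := by
  let e : Finset (Fin k) ≃ (Fin k → Bool) :=
    { toFun := fun S i => decide (i ∉ S)
      invFun := fun f => Finset.univ.filter fun j => f j = false
      left_inv := fun S => by ext; simp
      right_inv := fun f => by ext i; simp }
  rw [← e.sum_comp]
  have h1 : ∀ S : Finset (Fin k), (Finset.univ.filter fun j => e S j = false) = S :=
    fun S => e.left_inv S
  simp_rw [h1]
  have := Finset.sum_powerset_apply_card G (x := (Finset.univ : Finset (Fin k)))
  simpa using this

/-- The root is forced to be an up-triangle, so only the positions of the `j` down-triangles among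
the remaining `i + j` are free; the case `j = 0` is not a strip. -/
theorem tsum_strip (F : ℕ → ℕ → ℝ≥0∞) :
    ∑' s : Strip, F s.nUp s.nDown =
      ∑' i, ∑' j, ((i + j).choose j : ℝ≥0∞) * if j = 0 then 0 else F (i + 1) j := by
  rw [tsum_strip_tail, ← ENNReal.tsum_prod
    (f := fun i j => ((i + j).choose j : ℝ≥0∞) * if j = 0 then 0 else F (i + 1) j),
    ← Finset.HasAntidiagonal.sigmaAntidiagonalEquivProd.tsum_eq, ENNReal.tsum_sigma']
  refine tsum_congr fun k => ?_
  rw [tsum_fintype]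
  refine Eq.trans ?_ (Finset.sum_coe_sort (Finset.HasAntidiagonal.antidiagonal k)
    (fun z : ℕ × ℕ => ((z.1 + z.2).choose z.2 : ℝ≥0∞) *
      if z.2 = 0 then 0 else F (z.1 + 1) z.2)).symm
  rw [← Finset.HasAntidiagonal.map_swap_antidiagonal, Finset.sum_map,
    Finset.Nat.sum_antidiagonal_eq_sum_range_succ_mk]
  have h1 := sum_bool_fun k fun j => if j = 0 then 0 else F (k - j + 1) j
  refine Eq.trans (Finset.sum_congr rfl fun f _ => ?_) (h1.trans ?_)
  · by_cases h : ∃ j, f j = false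
    · have hd := nDown_ofTail f h
      have hp := nDown_pos (ofTail f h)
      have hu := nUp_pos (ofTail f h)
      have hs : (ofTail f h).nUp + (ofTail f h).nDown = k + 1 := nUp_add_nDown _
      rw [dif_pos h, ← hd, if_neg hp.ne',
        show k - (ofTail f h).nDown + 1 = (ofTail f h).nUp by omega]
    · rw [dif_neg h, if_pos]
      rw [Finset.card_eq_zero, Finset.filter_eq_empty_iff]
      intro j _ hj
      exact h ⟨j, hj⟩
  · refine Finset.sum_congr rfl fun j hj => ?_
    have : k - j + j = k := Nat.sub_add_cancel (Nat.lt_succ_iff.1 (Finset.mem_range.1 hj))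
    simp [this]

theorem exists_strip (u d : ℕ) (hu : 0 < u) (hd : 0 < d) :
    ∃ s : Strip, s.nUp = u ∧ s.nDown = d := by
  classical
  by_contra hcon
  push Not at hcon
  have h := tsum_strip fun a b => if a = u ∧ b = d then 1 else 0
  have h0 : ∑' s : Strip, (if s.nUp = u ∧ s.nDown = d then (1 : ℝ≥0∞) else 0) = 0 :=
    ENNReal.tsum_eq_zero.2 fun s => if_neg fun hs => hcon s hs.1 hs.2
  rw [h0] at h
  have h1 := (ENNReal.tsum_eq_zero.1 (ENNReal.tsum_eq_zero.1 h.symm (u - 1))) d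
  rw [if_neg hd.ne', if_pos ⟨Nat.sub_add_cancel hu, rfl⟩, mul_one, Nat.cast_eq_zero] at h1
  exact (Nat.choose_pos (Nat.le_add_left d (u - 1))).ne' h1

end Strip

theorem tsum_spinStrip (F : Strip → ℝ≥0∞) :
    ∑' x : SpinStrip, F x.1 = ∑' s : Strip, 2 ^ s.n * F s := by
  rw [ENNReal.tsum_sigma']
  refine tsum_congr fun s => ?_
  simp

/-- A strip with `k + 1` triangles has at most `2 ^ k` type patterns and `2 ^ (k + 1)` spin
configurations, leaving a geometric series of ratio `4 * g`. -/
theorem tsum_spinStrip_pow_ne_top {g : ℝ} (hg0 : 0 ≤ g) (hg : g < 1 / 4) :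
    ∑' x : SpinStrip, ENNReal.ofReal (g ^ x.1.n) ≠ ⊤ := by
  rw [tsum_spinStrip fun s => ENNReal.ofReal (g ^ s.n), Strip.tsum_strip_tail]
  have hle : ∀ k : ℕ, (∑ f : Fin k → Bool, if h : ∃ j, f j = false then
      2 ^ (Strip.ofTail f h).n * ENNReal.ofReal (g ^ (Strip.ofTail f h).n) else 0) ≤
      2 * ENNReal.ofReal g * ENNReal.ofReal (4 * g) ^ k := by
    intro k
    calc _ ≤ ∑ f : Fin k → Bool, (2 : ℝ≥0∞) ^ (k + 1) * ENNReal.ofReal (g ^ (k + 1)) := by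
          refine Finset.sum_le_sum fun f _ => ?_
          split_ifs
          · exact le_rfl
          · exact zero_le
      _ = 2 * ENNReal.ofReal g * ENNReal.ofReal (4 * g) ^ k := by
          rw [Finset.sum_const, Finset.card_univ, Fintype.card_fun, Fintype.card_bool,
            Fintype.card_fin, nsmul_eq_mul, ENNReal.ofReal_pow hg0,
            ENNReal.ofReal_mul (by norm_num), mul_pow, pow_succ, pow_succ]
          have h4 : ENNReal.ofReal 4 = 2 * 2 := by
            rw [show (4 : ℝ) = 2 * 2 by norm_num, ENNReal.ofReal_mul (by norm_num)]
            simp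
          rw [h4, mul_pow]
          push_cast
          ring
  refine ne_top_of_le_ne_top ?_ (ENNReal.tsum_le_tsum hle)
  rw [ENNReal.tsum_mul_left, ENNReal.tsum_geometric]
  refine ENNReal.mul_ne_top (ENNReal.mul_ne_top (by norm_num) ENNReal.ofReal_ne_top) ?_
  refine ENNReal.inv_ne_top.2 ?_
  rw [Ne, tsub_eq_zero_iff_le, not_le, ENNReal.ofReal_lt_one]
  linarith

/-- Above the critical fugacity, pure causal triangulations have infinite partition function. -/
theorem tsum_cdt_pow_eq_top {g : ℝ} (hg : 1 / 2 < g) {N : ℕ} (hN : 1 ≤ N) :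
    ∑' t : CDT N, ENNReal.ofReal (g ^ t.size) = ⊤ := by
  have hg0 : 0 < g := by linarith
  -- Keep only the triangulations whose circles all have `u` edges: compatibility is then automatic
  -- and the strips are independent.
  have hlow : ∀ u : ℕ, 0 < u → ENNReal.ofReal (((u - 1 + u).choose u : ℝ) * g ^ (2 * u)) ^ N ≤
      ∑' t : CDT N, ENNReal.ofReal (g ^ t.size) := by
    intro u hu
    have h1 : ∑' s : {s : Strip // s.nUp = u ∧ s.nDown = u}, ENNReal.ofReal (g ^ s.1.n) =
        ENNReal.ofReal (((u - 1 + u).choose u : ℝ) * g ^ (2 * u)) := by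
      classical
      have h2 := Strip.tsum_strip fun a b => if a = u ∧ b = u then ENNReal.ofReal (g ^ (a + b))
        else 0
      refine (tsum_subtype {s : Strip | s.nUp = u ∧ s.nDown = u}
        fun s => ENNReal.ofReal (g ^ s.n)).trans (Eq.trans (tsum_congr fun s => ?_) (h2.trans ?_))
      · rw [Strip.nUp_add_nDown]
        simp only [Set.indicator, Set.mem_ofPred_eq]
      · rw [tsum_eq_single (u - 1), tsum_eq_single u, if_neg hu.ne',
          if_pos ⟨Nat.sub_add_cancel hu, rfl⟩, Nat.sub_add_cancel hu,
          ENNReal.ofReal_mul (by positivity), ENNReal.ofReal_natCast, two_mul]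
        · intro j hj
          simp [hj]
        · intro i hi
          refine ENNReal.tsum_eq_zero.2 fun j => ?_
          have : i + 1 ≠ u := by omega
          simp [this]
    rw [← h1, ← tsum_prod_fin]
    let ι : (Fin N → {s : Strip // s.nUp = u ∧ s.nDown = u}) → CDT N := fun p =>
      ⟨fun i => (p i).1, fun i => (p i).2.2.trans (p _).2.1.symm⟩
    have hι : Function.Injective ι := fun p q h => by
      have h' := congrArg CDT.strip h
      funext i
      exact Subtype.ext (congrFun h' i)
    refine le_trans (le_of_eq (tsum_congr fun p => ?_)) (ENNReal.tsum_comp_le_tsum_of_injective hι _)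
    rw [← ENNReal.ofReal_prod_of_nonneg fun _ _ => pow_nonneg hg0.le _, Finset.prod_pow_eq_pow_sum]
    rfl
  by_contra hne
  have htend : Tendsto (fun u : ℕ => (4 * g ^ 2) ^ u / (2 * u)) atTop atTop := by
    have h1 := tendsto_pow_const_div_const_pow_of_one_lt 1 (r := 4 * g ^ 2) (by nlinarith)
    have h2 : Tendsto (fun u : ℕ => 2 * ((u : ℝ) ^ 1 / (4 * g ^ 2) ^ u)) atTop (𝓝[>] 0) := by
      refine tendsto_nhdsWithin_iff.2 ⟨by simpa using h1.const_mul 2, ?_⟩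
      filter_upwards [eventually_gt_atTop 0] with u hu
      have : (0 : ℝ) < u := by positivity
      rw [Set.mem_Ioi]
      positivity
    refine (tendsto_inv_nhdsGT_zero.comp h2).congr fun u => ?_
    simp only [Function.comp, pow_one, mul_inv, inv_div]
    ring
  set S := ∑' t : CDT N, ENNReal.ofReal (g ^ t.size) with hS
  -- The `1` in the maximum ensures that the base below is at least one, so that its `N`-th power
  -- dominates it.
  have hev := (htend.eventually_gt_atTop (max 1 S.toReal)).and (eventually_ge_atTop 4)
  obtain ⟨u, hu1, hu4⟩ := hev.exists
  have hu0 : 0 < u := by omega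
  have hub : (4 * g ^ 2) ^ u / (2 * u) ≤ ((u - 1 + u).choose u : ℝ) * g ^ (2 * u) := by
    have hc : 4 ^ u < u * Nat.centralBinom u := Nat.four_pow_lt_mul_centralBinom u hu4
    have hc2 : Nat.centralBinom u = 2 * (u - 1 + u).choose u := by
      obtain ⟨v, rfl⟩ : ∃ v, u = v + 1 := ⟨u - 1, by omega⟩
      rw [Nat.centralBinom_eq_two_mul_choose, show 2 * (v + 1) = (2 * v + 1) + 1 by ring,
        Nat.choose_succ_succ, show v + 1 - 1 + (v + 1) = 2 * v + 1 by omega,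
        Nat.succ_eq_add_one, Nat.choose_symm_half]
      ring
    rw [hc2] at hc
    have hc' : (4 : ℝ) ^ u ≤ u * (2 * ((u - 1 + u).choose u : ℝ)) := by exact_mod_cast hc.le
    have hu' : (0 : ℝ) < u := by positivity
    rw [div_le_iff₀ (by positivity), mul_pow, ← pow_mul]
    nlinarith [pow_pos hg0 (2 * u)]
  have h3 : max 1 S.toReal < ((u - 1 + u).choose u : ℝ) * g ^ (2 * u) := hu1.trans_le hub
  have h4 := hlow u hu0
  have h5 : ((u - 1 + u).choose u : ℝ) * g ^ (2 * u) ≤ S.toReal := by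
    have h6 := ENNReal.toReal_mono hne h4
    rw [ENNReal.toReal_pow, ENNReal.toReal_ofReal (by positivity)] at h6
    refine le_trans ?_ h6
    exact le_self_pow₀ ((le_max_left _ _).trans h3.le) (by omega)
  exact absurd ((le_max_right _ _).trans_lt h3) (not_lt.2 h5)

/-! ### Comparison of the Ising weights -/

theorem abs_spin_mul (a : ℤˣ) : |((a : ℤ) : ℝ)| = 1 := by
  rcases Int.units_eq_one_or a with rfl | rfl <;> simp

theorem neg_innerEnergy_le (t : Strip) (σ : t.Spins) : -t.innerEnergy σ ≤ t.n := by
  rw [Strip.innerEnergy, neg_neg]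
  refine (Finset.sum_le_sum fun k _ => (le_abs_self _).trans (abs_spin_mul _).le).trans ?_
  simp

theorem neg_interEnergy_le (s t : Strip) (h : s.nDown = t.nUp) (σ : s.Spins) (τ : t.Spins) :
    -s.interEnergy t h σ τ ≤ s.nDown := by
  rw [Strip.interEnergy, neg_neg]
  refine (Finset.sum_le_sum fun k _ => (le_abs_self _).trans (abs_spin_mul _).le).trans ?_
  simp

/-- With all spin products replaced by one, the gauge `γ = β` spreads the weight of the shared
circle evenly: using `x.1.nDown = y.1.nUp`, the energy contribution becomes exactly `3β/4` times the
total number of triangles. Hence the bound holds pointwise, with `μ` shifted by `3β/2`. -/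
theorem transfer_le_transfer_zero {β : ℝ} (hβ : 0 ≤ β) (μ : ℝ) (x y : SpinStrip) :
    transfer β μ β x y ≤ transfer 0 (μ - 3 / 2 * β) 0 x y := by
  unfold transfer
  split_ifs with h
  · refine ENNReal.ofReal_le_ofReal (Real.exp_le_exp.2 ?_)
    have h1 := neg_innerEnergy_le x.1 x.2
    have h2 := neg_innerEnergy_le y.1 y.2
    have h3 := neg_interEnergy_le x.1 y.1 h x.2 y.2
    have h4 : (x.1.nUp : ℝ) + x.1.nDown = x.1.n := by exact_mod_cast x.1.nUp_add_nDown
    have h5 : (y.1.nUp : ℝ) + y.1.nDown = y.1.n := by exact_mod_cast y.1.nUp_add_nDown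
    have h6 : (x.1.nDown : ℝ) = y.1.nUp := by exact_mod_cast h
    simp only [SpinStrip.inner, interaction, dif_pos h]
    have e1 := mul_le_mul_of_nonneg_left h1 hβ
    have e2 := mul_le_mul_of_nonneg_left h2 hβ
    have e3 := mul_le_mul_of_nonneg_left h3 hβ
    rw [← h4, ← h5, h6] at *
    nlinarith
  · exact le_rfl

theorem partitionFunction_le_zero {β : ℝ} (hβ : 0 ≤ β) (μ : ℝ) (N : ℕ) :
    partitionFunction N β μ ≤ partitionFunction N 0 (μ - 3 / 2 * β) := by
  rw [← loopSum_transfer N β μ β, ← loopSum_transfer N 0 (μ - 3 / 2 * β) 0]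
  exact loopSum_mono (transfer_le_transfer_zero hβ μ) N

/-- After comparison with `β = 0`, forgetting compatibility turns the double sum into a product of
two one-strip sums, convergent for fugacity below `1/4`. -/
theorem hsNorm_transfer_ne_top {β μ : ℝ} (hβ : 0 ≤ β) (hμ : 3 / 2 * β + 2 * Real.log 2 < μ) :
    hsNorm (transfer β μ β) ≠ ⊤ := by
  have hg : Real.exp (-(μ - 3 / 2 * β)) < 1 / 4 := by
    rw [← Real.lt_log_iff_exp_lt (by norm_num), show (1 / 4 : ℝ) = (2 ^ 2)⁻¹ by norm_num,
      Real.log_inv, Real.log_pow]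
    push_cast
    linarith
  have hfin := tsum_spinStrip_pow_ne_top (Real.exp_pos _).le hg
  set S := ∑' x : SpinStrip, ENNReal.ofReal (Real.exp (-(μ - 3 / 2 * β)) ^ x.1.n) with hS
  refine ne_top_of_le_ne_top (ENNReal.mul_ne_top hfin hfin) ?_
  rw [hS, ← ENNReal.tsum_mul_right]
  refine ENNReal.tsum_le_tsum fun x => ?_
  rw [← ENNReal.tsum_mul_left]
  refine ENNReal.tsum_le_tsum fun y => ?_
  calc transfer β μ β x y ^ 2 ≤ transfer 0 (μ - 3 / 2 * β) 0 x y ^ 2 := by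
        gcongr; exact transfer_le_transfer_zero hβ μ x y
    _ ≤ _ := by
        unfold transfer
        split_ifs
        · rw [← ENNReal.ofReal_pow (Real.exp_pos _).le,
            ← ENNReal.ofReal_mul (pow_nonneg (Real.exp_pos _).le _), ← Real.exp_nat_mul,
            ← Real.exp_nat_mul, ← Real.exp_nat_mul, ← Real.exp_add]
          refine ENNReal.ofReal_le_ofReal (Real.exp_le_exp.2 (le_of_eq ?_))
          push_cast
          ring
        · simp

theorem one_lt_n (t : Strip) : 1 < t.n := by
  have := t.nUp_add_nDown
  have := t.nUp_pos
  have := t.nDown_pos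
  omega

theorem finRotate_ne {n : ℕ} (hn : 1 < n) (k : Fin n) : finRotate n k ≠ k := by
  obtain ⟨l, rfl⟩ : ∃ l, n = l + 2 := ⟨n - 2, by omega⟩
  rw [finRotate_apply]
  simp

theorem sum_eq_zero_of_mul_neg {G : Type*} [Group G] [Fintype G] (δ : G) (F : G → ℝ)
    (h : ∀ σ, F (δ * σ) = -F σ) : ∑ σ, F σ = 0 := by
  have h1 : ∑ σ, F (δ * σ) = ∑ σ, F σ := Equiv.sum_comp (Equiv.mulLeft δ) F
  simp only [h, Finset.sum_neg_distrib] at h1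
  linarith

theorem Strip.isUp_up (t : Strip) (l : Fin t.nUp) : t.isUp (t.up l) = true :=
  (Finset.mem_filter.1 (t.ups.orderEmbOfFin_mem rfl l)).2

theorem Strip.isUp_down (t : Strip) (l : Fin t.nDown) : t.isUp (t.down l) = false :=
  (Finset.mem_filter.1 (t.downs.orderEmbOfFin_mem rfl l)).2

/-- Since `exp x ≥ 1 + x`, it suffices that the energy has mean zero over uniform spins, which is
shown bond by bond with a sign-reversing flip. -/
theorem isingZ_zero_le {N : ℕ} (t : CDT N) (β : ℝ) : t.isingZ 0 ≤ t.isingZ β := by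
  have hin : ∀ i, ∑ σ : t.Spins, (t.strip i).innerEnergy (σ i) = 0 := by
    intro i
    simp only [Strip.innerEnergy, Finset.sum_neg_distrib, neg_eq_zero]
    rw [Finset.sum_comm]
    refine Finset.sum_eq_zero fun k _ => ?_
    refine sum_eq_zero_of_mul_neg (Pi.mulSingle i (Pi.mulSingle k (-1)) : t.Spins) _ fun σ => ?_
    have hne := finRotate_ne (one_lt_n (t.strip i)) k
    simp [Pi.mulSingle_eq_of_ne hne, -finRotate_apply]
  have hint : ∀ i, ∑ σ : t.Spins, (t.strip i).interEnergy (t.strip (finRotate N i)) (t.compat i)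
        (σ i) (σ (finRotate N i)) = 0 := by
    intro i
    simp only [Strip.interEnergy, Finset.sum_neg_distrib, neg_eq_zero]
    rw [Finset.sum_comm]
    refine Finset.sum_eq_zero fun k _ => ?_
    -- Flip all down-triangles at once. A bond between strips joins a down-triangle to an
    -- up-triangle, so its sign changes, even when `N = 1` and the strip is glued to itself.
    refine sum_eq_zero_of_mul_neg
      ((fun j l => if (t.strip j).isUp l = true then 1 else -1) : t.Spins) _ fun σ => ?_
    simp only [Pi.mul_apply, Strip.isUp_up, Strip.isUp_down]
    simp
  have hlow : ∑ σ : t.Spins, (1 + ∑ i, (-β * (t.strip i).innerEnergy (σ i)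
      - β * (t.strip i).interEnergy (t.strip (finRotate N i)) (t.compat i)
        (σ i) (σ (finRotate N i)))) = t.isingZ 0 := by
    rw [Finset.sum_add_distrib, Finset.sum_comm]
    simp only [Finset.sum_sub_distrib, ← Finset.mul_sum, hin, hint, CDT.isingZ]
    simp
  rw [← hlow, CDT.isingZ]
  refine Finset.sum_le_sum fun σ _ => ?_
  rw [← Real.exp_sum, add_comm]
  exact Real.add_one_le_exp _

theorem isingZ_zero {N : ℕ} (t : CDT N) : t.isingZ 0 = 2 ^ t.size := by
  simp [CDT.isingZ, CDT.size, Finset.prod_pow_eq_pow_sum]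

theorem partitionFunction_zero_le (β μ : ℝ) (N : ℕ) :
    partitionFunction N 0 μ ≤ partitionFunction N β μ :=
  ENNReal.tsum_le_tsum fun t => ENNReal.ofReal_le_ofReal <|
    mul_le_mul_of_nonneg_left (isingZ_zero_le t β) (Real.exp_pos _).le

theorem partitionFunction_zero (μ : ℝ) (N : ℕ) :
    partitionFunction N 0 μ = ∑' t : CDT N, ENNReal.ofReal ((2 * Real.exp (-μ)) ^ t.size) := by
  refine tsum_congr fun t => ?_
  rw [isingZ_zero, mul_pow, ← Real.exp_nat_mul]
  congr 1
  rw [mul_comm (t.size : ℝ), mul_comm]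

/-- Keep the all-plus configuration. Every triangle has three edges, each shared by two triangles,
so there are `3/2` bonds per triangle. -/
theorem le_isingZ {N : ℕ} (t : CDT N) (β : ℝ) :
    Real.exp (3 / 2 * β * t.size) ≤ t.isingZ β := by
  rw [CDT.isingZ]
  refine le_trans (le_of_eq ?_) (Finset.single_le_sum
    (fun σ _ => Finset.prod_nonneg fun _ _ => (Real.exp_pos _).le)
    (Finset.mem_univ (fun _ _ => 1 : t.Spins)))
  rw [← Real.exp_sum]
  congr 1
  have h1 : ∑ i, ((t.strip i).nDown : ℝ) = ∑ i, ((t.strip i).nUp : ℝ) := by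
    rw [← sum_finRotate fun i => ((t.strip i).nUp : ℝ)]
    exact Finset.sum_congr rfl fun i _ => by rw [t.compat i]
  have h2 : (t.size : ℝ) = ∑ i, ((t.strip i).nUp : ℝ) + ∑ i, ((t.strip i).nDown : ℝ) := by
    rw [CDT.size, ← Finset.sum_add_distrib]
    push_cast
    exact Finset.sum_congr rfl fun i _ => by exact_mod_cast (t.strip i).nUp_add_nDown.symm
  have h3 : ∑ i, ((t.strip i).n : ℝ) = t.size := by simp [CDT.size]
  simp only [Strip.innerEnergy, Strip.interEnergy, mul_one, Units.val_one, Int.cast_one,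
    Finset.sum_const, Finset.card_univ, Fintype.card_fin, nsmul_eq_mul]
  simp only [neg_mul, neg_neg, mul_neg, sub_neg_eq_add, Finset.sum_add_distrib, ← Finset.mul_sum]
  rw [h3]
  linear_combination (-β / 2 : ℝ) * h1 + β / 2 * h2

/-- The `log 2` branch of `f₁` comes from comparison with `β = 0`. The other comes from the all-plus
term, which even gives the stronger threshold `3β/2 + log 2`, because `2 sinh β ≤ exp β`. -/
theorem partitionFunction_eq_top {β μ : ℝ} {N : ℕ} (hN : 1 ≤ N)
    (h : μ < f₁ β + Real.log 2) (hβ : 0 < β) : partitionFunction N β μ = ⊤ := by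
  rw [f₁] at h
  rcases lt_max_iff.1 (sub_lt_iff_lt_add.2 h) with h | h
  · refine top_le_iff.1 (le_trans (le_of_eq ?_) (partitionFunction_zero_le β μ N))
    rw [partitionFunction_zero, tsum_cdt_pow_eq_top _ hN]
    have : Real.exp (-(2 * Real.log 2)) < Real.exp (-μ) := Real.exp_lt_exp.2 (by linarith)
    rw [← mul_neg, ← Real.log_inv, mul_comm, Real.exp_mul, Real.exp_log (by norm_num)] at this
    norm_num at this ⊢
    linarith
  · have h2 : Real.log (2 * Real.sinh β) ≤ β := by
      rw [Real.log_le_iff_le_exp (by have := Real.sinh_pos_iff.2 hβ; positivity), Real.sinh_eq]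
      have := Real.exp_pos (-β)
      linarith
    refine top_le_iff.1 (le_trans (le_of_eq ?_) (ENNReal.tsum_le_tsum fun t =>
      ENNReal.ofReal_le_ofReal (mul_le_mul_of_nonneg_left (le_isingZ t β) (Real.exp_pos _).le)))
    rw [← tsum_cdt_pow_eq_top (g := Real.exp (3 / 2 * β - μ)) _ hN]
    · refine tsum_congr fun t => ?_
      rw [← Real.exp_nat_mul, ← Real.exp_add]
      congr 2
      ring
    · rw [← Real.log_lt_iff_lt_exp (by norm_num), one_div, Real.log_inv]
      linarith

/-! ### Strict monotonicity and primitivity -/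

theorem two_mul_le_size {N : ℕ} (t : CDT N) : 2 * N ≤ t.size := by
  have : ∑ i : Fin N, 2 ≤ ∑ i, (t.strip i).n := Finset.sum_le_sum fun i _ => one_lt_n _
  simpa [mul_comm, CDT.size] using this

/-- Each strip has at least two triangles. The resulting gain, exponential in `N`, survives in the
limit and is the source of strict monotonicity. -/
theorem partitionFunction_le_of_le {μ μ' : ℝ} (h : μ ≤ μ') (β : ℝ) (N : ℕ) :
    partitionFunction N β μ' ≤
      ENNReal.ofReal (Real.exp (-(2 * (μ' - μ)) * N)) * partitionFunction N β μ := by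
  rw [partitionFunction, partitionFunction, ← ENNReal.tsum_mul_left]
  refine ENNReal.tsum_le_tsum fun t => ?_
  rw [← ENNReal.ofReal_mul (Real.exp_pos _).le, ← mul_assoc, ← Real.exp_add]
  refine ENNReal.ofReal_le_ofReal (mul_le_mul_of_nonneg_right (Real.exp_le_exp.2 ?_)
    (Finset.sum_nonneg fun _ _ => Finset.prod_nonneg fun _ _ => (Real.exp_pos _).le))
  have : (2 * N : ℝ) ≤ t.size := by exact_mod_cast two_mul_le_size t
  nlinarith

theorem transfer_ne_zero (β μ γ : ℝ) {x y : SpinStrip} (h : x.1.nDown = y.1.nUp) :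
    transfer β μ γ x y ≠ 0 := by
  rw [transfer, if_pos h]
  simp [Real.exp_pos]

/-- Primitivity: any two strips can be joined through one intermediate strip with the two required
boundary lengths. -/
theorem kpow_two_transfer_ne_zero (β μ γ : ℝ) (x y : SpinStrip) :
    kpow (transfer β μ γ) 2 x y ≠ 0 := by
  obtain ⟨s, h1, h2⟩ := Strip.exists_strip x.1.nDown y.1.nUp x.1.nDown_pos y.1.nUp_pos
  let z : SpinStrip := ⟨s, fun _ => 1⟩
  rw [kpow_succ]
  simp_rw [kpow_one]
  intro h
  have := ENNReal.tsum_eq_zero.1 h z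
  exact mul_ne_zero (transfer_ne_zero β μ γ (y := z) h1.symm)
    (transfer_ne_zero β μ γ (x := z) h2) this

theorem exists_freeEnergy {β μ γ : ℝ} (h : hsNorm (transfer β μ γ) ≠ ⊤) {x₀ : SpinStrip}
    (hx : x₀.1.nDown = x₀.1.nUp) :
    ∃ L : ℝ, Tendsto (fun n : ℕ => Real.log (kpow (transfer β μ γ) n x₀ x₀).toReal / n) atTop
        (𝓝 L) ∧ Tendsto (fun n : ℕ => freeEnergyN n β μ) atTop (𝓝 (L : EReal)) := by
  obtain ⟨L, h1, h2⟩ := exists_tendsto_log_loopSum (transfer β μ γ) x₀ h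
    (transfer_ne_zero β μ γ hx) (kpow_two_transfer_ne_zero β μ γ x₀)
    (fun x => kpow_two_transfer_ne_zero β μ γ x x₀)
  refine ⟨L, h1, h2.congr fun n => ?_⟩
  rw [loopSum_transfer, freeEnergyN]

/-! ### Pure causal triangulations -/

section Moebius

variable {g : ℝ}

/-- The iterates of `g` under the map `z ↦ g / (1 - g z)`. -/
noncomputable def moebiusIter (g : ℝ) : ℕ → ℝ
  | 0 => g
  | n + 1 => g / (1 - g * moebiusIter g n)

/-- The fixed point of the map `z ↦ g / (1 - g z)`. -/
noncomputable def moebiusFix (g : ℝ) : ℝ := (1 - √(1 - 4 * g ^ 2)) / (2 * g)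

/-- The normalization of the iterated pure transfer kernel. -/
noncomputable def moebiusNorm (g : ℝ) : ℕ → ℝ
  | 0 => g
  | n + 1 => moebiusNorm g n * moebiusIter g n * moebiusIter g (n + 1)

theorem moebiusFix_pos (hg0 : 0 < g) : 0 < moebiusFix g := by
  refine div_pos ?_ (by positivity)
  rw [sub_pos, Real.sqrt_lt' one_pos]
  nlinarith [pow_pos hg0 2]

theorem moebiusFix_lt_one (hg0 : 0 < g) (hg : g < 1 / 2) : moebiusFix g < 1 := by
  rw [moebiusFix, div_lt_one (by positivity)]
  have : 1 - 2 * g < √(1 - 4 * g ^ 2) := Real.lt_sqrt_of_sq_lt (by nlinarith)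
  linarith

theorem moebiusFix_eq (hg0 : 0 < g) (hg : g < 1 / 2) :
    moebiusFix g * (1 - g * moebiusFix g) = g := by
  have hs : √(1 - 4 * g ^ 2) ^ 2 = 1 - 4 * g ^ 2 := Real.sq_sqrt (by nlinarith)
  rw [moebiusFix]
  field_simp
  nlinarith

theorem moebiusIter_mem (hg0 : 0 < g) (hg : g < 1 / 2) (n : ℕ) :
    0 < moebiusIter g n ∧ moebiusIter g n ≤ moebiusFix g := by
  have hf0 := moebiusFix_pos hg0
  have hf1 := moebiusFix_lt_one hg0 hg
  have hf := moebiusFix_eq hg0 hg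
  induction n with
  | zero =>
    refine ⟨hg0, ?_⟩
    rw [moebiusIter]
    nlinarith [mul_pos hf0 (mul_pos hg0 hf0)]
  | succ n ih =>
    have h1 : g * moebiusIter g n ≤ g * moebiusFix g := by gcongr; exact ih.2
    have h2 : g * moebiusFix g < 1 := by nlinarith
    have h3 : 0 < 1 - g * moebiusIter g n := by linarith
    refine ⟨div_pos hg0 h3, ?_⟩
    rw [moebiusIter, div_le_iff₀ h3]
    calc g = moebiusFix g * (1 - g * moebiusFix g) := hf.symm
      _ ≤ _ := by gcongr

theorem one_sub_pos (hg0 : 0 < g) (hg : g < 1 / 2) (n : ℕ) : 0 < 1 - g * moebiusIter g n := by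
  have := moebiusIter_mem hg0 hg n
  have := moebiusFix_lt_one hg0 hg
  nlinarith

/-- The distance to the fixed point is multiplied at each step by `moebiusIter g (n + 1) *
moebiusFix g`, which is at most `moebiusFix g ^ 2 < 1`. -/
theorem tendsto_moebiusIter (hg0 : 0 < g) (hg : g < 1 / 2) :
    Tendsto (moebiusIter g) atTop (𝓝 (moebiusFix g)) := by
  have hf0 := moebiusFix_pos hg0
  have hf1 := moebiusFix_lt_one hg0 hg
  have hf := moebiusFix_eq hg0 hg
  have hbound : ∀ n, moebiusFix g - moebiusIter g n ≤ (moebiusFix g ^ 2) ^ n := by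
    intro n
    induction n with
    | zero => rw [moebiusIter, pow_zero]; linarith
    | succ n ih =>
      have hp := one_sub_pos hg0 hg n
      have h1 : moebiusIter g (n + 1) * (1 - g * moebiusIter g n) = g :=
        div_mul_cancel₀ _ hp.ne'
      have hm := moebiusIter_mem hg0 hg n
      have hm' := moebiusIter_mem hg0 hg (n + 1)
      have hid : moebiusFix g - moebiusIter g (n + 1) =
          moebiusIter g (n + 1) * moebiusFix g * (moebiusFix g - moebiusIter g n) := by
        refine mul_left_cancel₀ hg0.ne' ?_
        linear_combination moebiusIter g (n + 1) * hf - moebiusFix g * h1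
      rw [hid, pow_succ']
      have : moebiusIter g (n + 1) * moebiusFix g ≤ moebiusFix g ^ 2 := by
        rw [sq]; gcongr; exact hm'.2
      exact mul_le_mul this ih (by linarith [hm.2]) (by positivity)
  have hlim : Tendsto (fun n => moebiusFix g - (moebiusFix g ^ 2) ^ n) atTop
      (𝓝 (moebiusFix g - 0)) :=
    tendsto_const_nhds.sub (tendsto_pow_atTop_nhds_zero_of_lt_one (by positivity) (by nlinarith))
  rw [sub_zero] at hlim
  exact tendsto_of_tendsto_of_tendsto_of_le_of_le hlim tendsto_const_nhds
    (fun n => by linarith [hbound n]) fun n => (moebiusIter_mem hg0 hg n).2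

theorem moebiusNorm_pos (hg0 : 0 < g) (hg : g < 1 / 2) (n : ℕ) : 0 < moebiusNorm g n := by
  induction n with
  | zero => exact hg0
  | succ n ih =>
    exact mul_pos (mul_pos ih (moebiusIter_mem hg0 hg n).1) (moebiusIter_mem hg0 hg (n + 1)).1

/-- Passing from `n` to `n + 1` multiplies the product by `moebiusIter g (n + 1) ^ 2`, so the
quotient is a Cesàro mean up to a vanishing term. -/
theorem tendsto_log_moebiusNorm (hg0 : 0 < g) (hg : g < 1 / 2) :
    Tendsto (fun n : ℕ => Real.log (moebiusNorm g n * moebiusIter g n) / n) atTop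
      (𝓝 (Real.log (moebiusFix g ^ 2))) := by
  have hz := fun n => (moebiusIter_mem hg0 hg n).1
  have hn := moebiusNorm_pos hg0 hg
  have hsum : ∀ n, Real.log (moebiusNorm g n * moebiusIter g n) =
      Real.log (g * g) + ∑ i ∈ Finset.range n, Real.log (moebiusIter g (i + 1) ^ 2) := by
    intro n
    induction n with
    | zero => simp [moebiusNorm, moebiusIter]
    | succ n ih =>
      rw [Finset.sum_range_succ, ← add_assoc, ← ih,
        ← Real.log_mul (mul_pos (hn n) (hz n)).ne' (pow_pos (hz _) 2).ne', moebiusNorm]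
      congr 1
      ring
  have hlog : Tendsto (fun n => Real.log (moebiusIter g (n + 1) ^ 2)) atTop
      (𝓝 (Real.log (moebiusFix g ^ 2))) :=
    (((tendsto_moebiusIter hg0 hg).comp (tendsto_add_atTop_nat 1)).pow 2).log
      (pow_pos (moebiusFix_pos hg0) 2).ne'
  have := (tendsto_const_div_atTop_nhds_zero_nat (Real.log (g * g))).add hlog.cesaro
  rw [zero_add] at this
  refine this.congr fun n => ?_
  rw [hsum, add_div, div_eq_inv_mul (∑ i ∈ _, _)]

/-- Functions `d ↦ α d z^d` are stable under the pure transfer operator: the factor `j` is absorbed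
through `C(i+j, j) j = (i+1) C(i+j, i+1)`, and the negative binomial series then sends `z` to `g /
(1 - g z)`. -/
theorem tsum_choose_mul_pow (hg0 : 0 < g) (hg : g < 1 / 2) (n i : ℕ) :
    ∑' j : ℕ, ((i + j).choose j : ℝ≥0∞) * (if j = 0 then 0 else ENNReal.ofReal (g ^ (i + 1 + j)) *
      ENNReal.ofReal (moebiusNorm g n * j * moebiusIter g n ^ j)) =
    ENNReal.ofReal (moebiusNorm g (n + 1) * ((i + 1 : ℕ) : ℝ) * moebiusIter g (n + 1) ^ (i + 1)) := by
  have hz := (moebiusIter_mem hg0 hg n).1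
  have hn := moebiusNorm_pos hg0 hg n
  have hp := one_sub_pos hg0 hg n
  set z := moebiusIter g n with hzdef
  set α := moebiusNorm g n with hα
  have hterm : ∀ k : ℕ, ((i + (k + 1)).choose (k + 1) : ℝ≥0∞) * (if k + 1 = 0 then 0 else
      ENNReal.ofReal (g ^ (i + 1 + (k + 1))) *
      ENNReal.ofReal (α * ((k + 1 : ℕ) : ℝ) * z ^ (k + 1))) =
      ENNReal.ofReal (α * g ^ (i + 1) * (i + 1 : ℕ) * (g * z) *
        (((k + (i + 1)).choose (i + 1) : ℝ) * (g * z) ^ k)) := by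
    intro k
    rw [if_neg (Nat.succ_ne_zero k), ← ENNReal.ofReal_natCast,
      ← ENNReal.ofReal_mul (by positivity), ← ENNReal.ofReal_mul (by positivity)]
    congr 1
    have hc : ((i + (k + 1)).choose (k + 1) : ℝ) * ((k + 1 : ℕ) : ℝ) =
        ((i + 1 : ℕ) : ℝ) * ((k + (i + 1)).choose (i + 1) : ℝ) := by
      have h1 := Nat.add_one_mul_choose_eq (k + i) k
      have h2 := Nat.add_one_mul_choose_eq (k + i) i
      have h3 : (k + i).choose i = (k + i).choose k := by
        rw [Nat.choose_symm_add]
      rw [h3, h1] at h2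
      rw [show i + (k + 1) = (k + i).succ by simp only [Nat.succ_eq_add_one]; ring,
        show k + (i + 1) = (k + i).succ by rfl]
      have h4 : ((k + i).succ.choose (k + 1) : ℝ) * ((k + 1 : ℕ) : ℝ) =
        ((k + i).succ.choose (i + 1) : ℝ) * ((i + 1 : ℕ) : ℝ) := by exact_mod_cast h2
      rw [h4, mul_comm]
    calc _ = ((i + (k + 1)).choose (k + 1) : ℝ) * ((k + 1 : ℕ) : ℝ) *
          (g ^ (i + 1 + (k + 1)) * (α * z ^ (k + 1))) := by ring
      _ = _ := by rw [hc]; ring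
  rw [tsum_eq_zero_add' ENNReal.summable]
  simp_rw [hterm]
  have hgz : ‖g * z‖ < 1 := by
    rw [Real.norm_of_nonneg (by positivity)]
    linarith
  have hs := (hasSum_choose_mul_geometric_of_norm_lt_one (i + 1) hgz).mul_left
    (α * g ^ (i + 1) * (i + 1 : ℕ) * (g * z))
  rw [← ENNReal.ofReal_tsum_of_nonneg (fun k => by positivity) hs.summable, hs.tsum_eq]
  simp only [if_true, mul_zero, zero_add]
  congr 1
  rw [moebiusNorm, ← hzdef, ← hα, moebiusIter, ← hzdef, div_pow]
  field_simp
  ring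

end Moebius

/-- The iterated pure transfer kernel as a function of the upper boundary length. -/
noncomputable def pureIter (g : ℝ) : ℕ → ℕ → ℝ≥0∞
  | 0 => fun d => if d = 1 then 1 else 0
  | n + 1 => fun d => ∑' s : Strip, if d = s.nUp then ENNReal.ofReal (g ^ s.n) *
      pureIter g n s.nDown else 0

theorem pureIter_succ_eq (g : ℝ) (n i : ℕ) : pureIter g (n + 1) (i + 1) =
    ∑' j : ℕ, ((i + j).choose j : ℝ≥0∞) * (if j = 0 then 0 else ENNReal.ofReal (g ^ (i + 1 + j)) *
      pureIter g n j) := by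
  have h := Strip.tsum_strip fun u d => if i + 1 = u then ENNReal.ofReal (g ^ (u + d)) *
      pureIter g n d else 0
  simp only [Strip.nUp_add_nDown] at h
  change ∑' s : Strip, _ = _
  rw [h, tsum_eq_single i]
  · simp
  · intro k hk
    simp [Ne.symm hk]

theorem pureIter_succ {g : ℝ} (hg0 : 0 < g) (hg : g < 1 / 2) (n i : ℕ) :
    pureIter g (n + 1) (i + 1) =
      ENNReal.ofReal (moebiusNorm g n * ((i + 1 : ℕ) : ℝ) * moebiusIter g n ^ (i + 1)) := by
  induction n generalizing i with
  | zero =>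
    rw [pureIter_succ_eq, tsum_eq_single 1]
    · rw [if_neg one_ne_zero, show pureIter g 0 1 = 1 by simp [pureIter], mul_one, Nat.choose_one_right,
        ← ENNReal.ofReal_natCast, ← ENNReal.ofReal_mul (by positivity), moebiusNorm, moebiusIter]
      congr 1
      ring
    · intro j hj
      simp [pureIter, hj]
  | succ n ih =>
    rw [pureIter_succ_eq, ← tsum_choose_mul_pow hg0 hg]
    refine tsum_congr fun j => ?_
    rcases j with _ | j
    · simp
    · rw [ih]

/-- At `β = 0` the spins of each intermediate strip contribute a factor two per triangle, absorbed
into the fugacity `2 * exp (-μ)`; only the half-weights of the two end strips are left over. -/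
theorem kpow_pure (μ : ℝ) {x₀ : SpinStrip} (hx : x₀.1.nUp = 1) (n : ℕ) (x : SpinStrip) :
    kpow (transfer 0 μ 0) (n + 1) x x₀ =
      ENNReal.ofReal (Real.exp (-μ / 2 * (x.1.n + x₀.1.n))) *
        pureIter (2 * Real.exp (-μ)) n x.1.nDown := by
  induction n generalizing x with
  | zero =>
    rw [kpow_one, transfer, hx]
    split_ifs with h <;> simp [pureIter, h]
  | succ n ih =>
    rw [kpow_succ, pureIter, ← ENNReal.tsum_mul_left]
    simp_rw [ih]
    have h := tsum_spinStrip fun s => if x.1.nDown = s.nUp then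
      ENNReal.ofReal (Real.exp (-μ / 2 * (x.1.n + s.n))) *
        (ENNReal.ofReal (Real.exp (-μ / 2 * (s.n + x₀.1.n))) *
        pureIter (2 * Real.exp (-μ)) n s.nDown) else 0
    refine Eq.trans (tsum_congr fun y => ?_) (h.trans (tsum_congr fun s => ?_))
    · rw [transfer]
      split_ifs <;> simp
    · split_ifs
      · rw [← mul_assoc, ← mul_assoc, ← mul_assoc]
        congr 1
        have h2 : (2 : ℝ≥0∞) ^ s.n = ENNReal.ofReal (2 ^ s.n) := by
          rw [ENNReal.ofReal_pow (by norm_num)]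
          simp
        rw [h2, ← ENNReal.ofReal_mul (by positivity), ← ENNReal.ofReal_mul (by positivity),
          ← ENNReal.ofReal_mul (by positivity), mul_pow, ← Real.exp_nat_mul]
        congr 1
        calc _ = 2 ^ s.n * (Real.exp (-μ / 2 * (x.1.n + s.n)) *
              Real.exp (-μ / 2 * (s.n + x₀.1.n))) := by ring
          _ = 2 ^ s.n * (Real.exp (-μ / 2 * (x.1.n + x₀.1.n)) * Real.exp (s.n * -μ)) := by
            rw [← Real.exp_add, ← Real.exp_add]
            congr 2
            ring
          _ = _ := by ring
      · simp

theorem two_mul_exp_neg_lt {μ : ℝ} (h : 2 * Real.log 2 < μ) : 2 * Real.exp (-μ) < 1 / 2 := by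
  have : Real.exp (-μ) < Real.exp (-(2 * Real.log 2)) := Real.exp_lt_exp.2 (by linarith)
  rw [← mul_neg, ← Real.log_inv, mul_comm, Real.exp_mul, Real.exp_log (by norm_num)] at this
  norm_num at this ⊢
  linarith

theorem Lam_sub_log_two (μ : ℝ) :
    Lam (μ - Real.log 2) = moebiusFix (2 * Real.exp (-μ)) ^ 2 := by
  have h1 : Real.exp (-(μ - Real.log 2)) = 2 * Real.exp (-μ) := by
    rw [neg_sub, sub_eq_add_neg, Real.exp_add, Real.exp_log (by norm_num)]
  have h2 : Real.exp (-2 * (μ - Real.log 2)) = (2 * Real.exp (-μ)) ^ 2 := by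
    rw [← h1, ← Real.exp_nat_mul]
    congr 1
    push_cast
    ring
  rw [Lam, h1, h2, moebiusFix]

/-- The free energy of pure causal triangulations. -/
theorem tendsto_freeEnergyN_zero {μ : ℝ} (h : 2 * Real.log 2 < μ) :
    Tendsto (fun n : ℕ => freeEnergyN n 0 μ) atTop
      (𝓝 ((Real.log (Lam (μ - Real.log 2)) : ℝ) : EReal)) := by
  obtain ⟨s, hs1, hs2⟩ := Strip.exists_strip 1 1 one_pos one_pos
  let x₀ : SpinStrip := ⟨s, fun _ => 1⟩
  have hhs : hsNorm (transfer 0 μ 0) ≠ ⊤ := hsNorm_transfer_ne_top le_rfl (by linarith)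
  obtain ⟨L, h1, h2⟩ := exists_freeEnergy hhs (x₀ := x₀) (hs2.trans hs1.symm)
  set g := 2 * Real.exp (-μ) with hgdef
  have hg0 : 0 < g := by positivity
  have hg : g < 1 / 2 := two_mul_exp_neg_lt h
  -- The rate can be read off any admissible diagonal entry. The base strip has boundary lengths
  -- `(1, 1)`, for which the entry is explicit.
  have hL : L = Real.log (Lam (μ - Real.log 2)) := by
    rw [Lam_sub_log_two]
    have h3 := (h1.comp (tendsto_add_atTop_nat 2))
    refine tendsto_nhds_unique h3 ?_
    have hx1 : x₀.1.nDown = 0 + 1 := hs2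
    set w := Real.exp (-μ / 2 * (x₀.1.n + x₀.1.n)) with hw
    have hpos : ∀ n, 0 < moebiusNorm g n * moebiusIter g n := fun n =>
      mul_pos (moebiusNorm_pos hg0 hg n) (moebiusIter_mem hg0 hg n).1
    have hval : ∀ n : ℕ, (kpow (transfer 0 μ 0) (n + 2) x₀ x₀).toReal =
        w * (moebiusNorm g n * moebiusIter g n) := by
      intro n
      rw [kpow_pure μ hs1, hx1, pureIter_succ hg0 hg, ← ENNReal.ofReal_mul (Real.exp_pos _).le,
        ENNReal.toReal_ofReal]
      · simp [hw]
      · have := moebiusNorm_pos hg0 hg n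
        have := (moebiusIter_mem hg0 hg n).1
        positivity
    have hshift : Tendsto (fun n : ℕ => (n : ℝ) / ((n + 2 : ℕ) : ℝ)) atTop (𝓝 1) := by
      simpa using tendsto_natCast_div_add_atTop (2 : ℝ)
    have hc : Tendsto (fun n : ℕ => Real.log w / ((n + 2 : ℕ) : ℝ)) atTop (𝓝 0) :=
      (tendsto_const_div_atTop_nhds_zero_nat (Real.log w)).comp (tendsto_add_atTop_nat 2)
    have h4 := hc.add ((tendsto_log_moebiusNorm hg0 hg).mul hshift)
    rw [zero_add, mul_one] at h4
    refine h4.congr' ?_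
    filter_upwards [eventually_gt_atTop 0] with n hn
    have hn0 : (n : ℝ) ≠ 0 := by positivity
    have hn2 : ((n + 2 : ℕ) : ℝ) ≠ 0 := by positivity
    simp only [Function.comp, hval]
    rw [Real.log_mul (Real.exp_pos _).ne' (hpos n).ne', add_div]
    congr 1
    field_simp
  rwa [← hL]

/-! ### Sums over words of triangles -/

section Words

variable {S : Type*}

/-- The weight of a word of triangles, entered from a triangle with spin `r`. -/
noncomputable def wordWeight (B : S → S → ℝ≥0∞) : S → List (Bool × S) → ℝ≥0∞
  | _, [] => 1
  | r, a :: L => B r a.2 * wordWeight B a.2 L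

/-- The spins of the triangles of type `b`. -/
def marks (b : Bool) (L : List (Bool × S)) : List S := (L.filter fun a => a.1 == b).map Prod.snd

/-- The weight of a chain of marked triangles, once the others are summed over. -/
noncomputable def chainWeight (A : S → S → ℝ≥0∞) (κ : ℝ≥0∞) : S → List S → ℝ≥0∞
  | _, [] => κ
  | r, s :: l => A r s * chainWeight A κ s l

/-- The coupling of two lists of the same length. -/
noncomputable def pairWeight (D : S → S → ℝ≥0∞) : List S → List S → ℝ≥0∞
  | [], [] => 1
  | s :: l, t :: l' => D s t * pairWeight D l l'
  | _, _ => 0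

theorem marks_cons_same (b : Bool) (s : S) (L : List (Bool × S)) :
    marks b ((b, s) :: L) = s :: marks b L := by simp [marks]

theorem marks_cons_not (b : Bool) (s : S) (L : List (Bool × S)) :
    marks b ((!b, s) :: L) = marks b L := by simp [marks]

open Classical in
/-- The total weight of the words of length `n` with prescribed marked spins. -/
noncomputable def wordSum (B : S → S → ℝ≥0∞) (b : Bool) (n : ℕ) (r : S) (l : List S) : ℝ≥0∞ :=
  ∑' f : Fin n → Bool × S, if marks b (List.ofFn f) = l then wordWeight B r (List.ofFn f) else 0

theorem wordSum_zero_nil (B : S → S → ℝ≥0∞) (b : Bool) (r : S) : wordSum B b 0 r [] = 1 := by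
  simp [wordSum, marks, wordWeight]

theorem wordSum_zero_cons (B : S → S → ℝ≥0∞) (b : Bool) (r s : S) (l : List S) :
    wordSum B b 0 r (s :: l) = 0 := by
  simp [wordSum, marks]

open Classical in
-- Condition on the first triangle: an unmarked one leaves the prescribed list intact, a marked one
-- must be its head.
theorem wordSum_succ (B : S → S → ℝ≥0∞) (b : Bool) (n : ℕ) (r : S) (l : List S) :
    wordSum B b (n + 1) r l = (∑' s, B r s * wordSum B b n s l) +
      ∑' s, B r s * ∑' f : Fin n → Bool × S,
        if s :: marks b (List.ofFn f) = l then wordWeight B s (List.ofFn f) else 0 := by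
  have hb : ∀ F : Bool → ℝ≥0∞, ∑' b' : Bool, F b' = F (!b) + F b := by
    intro F
    rw [tsum_bool]
    cases b <;> simp [add_comm]
  simp only [wordSum]
  rw [tsum_fin_succ, ENNReal.tsum_prod', hb]
  congr 1
  all_goals
    refine tsum_congr fun s => ?_
    rw [← ENNReal.tsum_mul_left]
    refine tsum_congr fun f => ?_
    simp only [List.ofFn_succ, Fin.cons_zero, Fin.cons_succ, marks_cons_same, marks_cons_not,
      wordWeight]
    split_ifs <;> simp

theorem wordSum_succ_nil (B : S → S → ℝ≥0∞) (b : Bool) (n : ℕ) (r : S) :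
    wordSum B b (n + 1) r [] = ∑' s, B r s * wordSum B b n s [] := by
  rw [wordSum_succ]
  simp

theorem wordSum_succ_cons (B : S → S → ℝ≥0∞) (b : Bool) (n : ℕ) (r s : S) (l : List S) :
    wordSum B b (n + 1) r (s :: l) =
      (∑' t, B r t * wordSum B b n t (s :: l)) + B r s * wordSum B b n s l := by
  classical
  rw [wordSum_succ]
  congr 1
  rw [tsum_eq_single s]
  · simp [wordSum]
  · intro t ht
    simp [ht]

/-- The hypotheses say that `κ` and `A` are supersolutions of the first-letter recursion, `κ ≥ 1 +
Bκ` and `A ≥ BA + B`. Induction on the truncation length then bounds the sums without inverting `1 -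
B`. -/
theorem sum_wordSum_le {B A : S → S → ℝ≥0∞} {κ : ℝ≥0∞} (hκ : ∀ r, 1 + ∑' s, B r s * κ ≤ κ)
    (hA : ∀ r s, (∑' t, B r t * A t s) + B r s ≤ A r s) (b : Bool) (n : ℕ) (r : S) (l : List S) :
    ∑ k ∈ Finset.range n, wordSum B b k r l ≤ chainWeight A κ r l := by
  induction n generalizing r l with
  | zero => simp
  | succ n ih =>
    rw [Finset.sum_range_succ']
    rcases l with _ | ⟨s, l⟩
    · simp_rw [wordSum_succ_nil, wordSum_zero_nil]
      rw [← Summable.tsum_finsetSum fun _ _ => ENNReal.summable, add_comm]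
      refine le_trans ?_ (hκ r)
      gcongr with t
      rw [← Finset.mul_sum]
      gcongr
      exact ih t []
    · simp_rw [wordSum_succ_cons, wordSum_zero_cons]
      rw [Finset.sum_add_distrib, ← Summable.tsum_finsetSum fun _ _ => ENNReal.summable, add_zero,
        ← Finset.mul_sum]
      calc _ ≤ (∑' t, B r t * (A t s * chainWeight A κ s l)) + B r s * chainWeight A κ s l := by
            gcongr with t
            · rw [← Finset.mul_sum]
              gcongr
              exact ih t (s :: l)
            · exact ih s l
        _ = ((∑' t, B r t * A t s) + B r s) * chainWeight A κ s l := by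
            rw [add_mul, ← ENNReal.tsum_mul_right]
            simp_rw [mul_assoc]
        _ ≤ _ := by
            rw [chainWeight]
            gcongr
            exact hA r s

theorem tsum_wordSum_le {B A : S → S → ℝ≥0∞} {κ : ℝ≥0∞} (hκ : ∀ r, 1 + ∑' s, B r s * κ ≤ κ)
    (hA : ∀ r s, (∑' t, B r t * A t s) + B r s ≤ A r s) (b : Bool) (r : S) (l : List S) :
    ∑' k, wordSum B b k r l ≤ chainWeight A κ r l :=
  ENNReal.tsum_le_of_sum_range_le fun n => sum_wordSum_le hκ hA b n r l

theorem tsum_list (F : List S → ℝ≥0∞) : ∑' l, F l = ∑' n, ∑' f : Fin n → S, F (List.ofFn f) := by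
  rw [← List.equivSigmaTuple.symm.tsum_eq, ENNReal.tsum_sigma']
  rfl

theorem pairWeight_eq_zero (D : S → S → ℝ≥0∞) {l l' : List S} (h : l.length ≠ l'.length) :
    pairWeight D l l' = 0 := by
  induction l generalizing l' with
  | nil => cases l' <;> simp_all [pairWeight]
  | cons s l ih => cases l' <;> simp_all [pairWeight]

theorem pairWeight_ofFn (D : S → S → ℝ≥0∞) {a b : ℕ} (h : a = b) (f : Fin a → S) (f' : Fin b → S) :
    pairWeight D (List.ofFn f) (List.ofFn f') = ∏ l, D (f l) (f' (Fin.cast h l)) := by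
  subst h
  induction a with
  | zero => simp [pairWeight]
  | succ a ih =>
    rw [List.ofFn_succ, List.ofFn_succ, pairWeight, ih, Fin.prod_univ_succ]
    rfl

/-- Two coupled chains read in parallel form one chain on pairs of spins. As `v` is a
super-eigenvector of its transfer matrix, each further pair of marked triangles costs at most a
factor `lm`. -/
theorem tsum_pair_fin_le {A D : S → S → ℝ≥0∞} {κ lm C : ℝ≥0∞} {v : S → S → ℝ≥0∞}
    (hv : ∀ r r', ∑' s, ∑' s', A r s * A r' s' * D s s' * v s s' ≤ lm * v r r')
    (hC : ∀ r r', κ ^ 2 ≤ C * v r r') (n : ℕ) (r r' : S) :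
    ∑' f : Fin n → S, ∑' f' : Fin n → S, pairWeight D (List.ofFn f) (List.ofFn f') *
      (chainWeight A κ r (List.ofFn f) * chainWeight A κ r' (List.ofFn f')) ≤
      C * lm ^ n * v r r' := by
  induction n generalizing r r' with
  | zero =>
    simp only [List.ofFn_zero, pairWeight, chainWeight, tsum_fintype]
    simpa [sq] using hC r r'
  | succ n ih =>
    rw [tsum_fin_succ]
    simp_rw [tsum_fin_succ (n := n)]
    simp only [List.ofFn_succ, Fin.cons_zero, Fin.cons_succ, pairWeight, chainWeight]
    calc _ = ∑' s, ∑' s', A r s * A r' s' * D s s' * (∑' f : Fin n → S, ∑' f' : Fin n → S,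
            pairWeight D (List.ofFn f) (List.ofFn f') *
            (chainWeight A κ s (List.ofFn f) * chainWeight A κ s' (List.ofFn f'))) := by
          refine tsum_congr fun s => ?_
          rw [ENNReal.tsum_comm]
          refine tsum_congr fun s' => ?_
          simp_rw [← ENNReal.tsum_mul_left]
          refine tsum_congr fun f => tsum_congr fun f' => ?_
          ring
      _ ≤ ∑' s, ∑' s', A r s * A r' s' * D s s' * (C * lm ^ n * v s s') := by
          gcongr with s s'
          exact ih s s'
      _ = C * lm ^ n * ∑' s, ∑' s', A r s * A r' s' * D s s' * v s s' := by
          simp_rw [← ENNReal.tsum_mul_left]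
          refine tsum_congr fun s => tsum_congr fun s' => ?_
          ring
      _ ≤ C * lm ^ n * (lm * v r r') := by gcongr; exact hv r r'
      _ = _ := by ring

theorem tsum_pair_list_ne_top {A D : S → S → ℝ≥0∞} {κ lm C : ℝ≥0∞} {v : S → S → ℝ≥0∞}
    (hv : ∀ r r', ∑' s, ∑' s', A r s * A r' s' * D s s' * v s s' ≤ lm * v r r')
    (hC : ∀ r r', κ ^ 2 ≤ C * v r r') (hCt : C ≠ ⊤) (hvt : ∀ r r', v r r' ≠ ⊤) (hlm : lm < 1)
    (r r' : S) :
    ∑' l, ∑' l', pairWeight D l l' * (chainWeight A κ r l * chainWeight A κ r' l') ≠ ⊤ := by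
  rw [tsum_list]
  have h1 : ∀ n : ℕ, ∑' f : Fin n → S, ∑' l', pairWeight D (List.ofFn f) l' *
      (chainWeight A κ r (List.ofFn f) * chainWeight A κ r' l') ≤ C * lm ^ n * v r r' := by
    intro n
    refine le_trans (le_of_eq (tsum_congr fun f => ?_)) (tsum_pair_fin_le hv hC n r r')
    rw [tsum_list, tsum_eq_single n]
    intro k hk
    refine ENNReal.tsum_eq_zero.2 fun f' => ?_
    rw [pairWeight_eq_zero D (by simpa using hk.symm), zero_mul]
  refine ne_top_of_le_ne_top ?_ (ENNReal.tsum_le_tsum h1)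
  rw [ENNReal.tsum_mul_right, ENNReal.tsum_mul_left, ENNReal.tsum_geometric]
  refine ENNReal.mul_ne_top (ENNReal.mul_ne_top hCt (ENNReal.inv_ne_top.2 ?_)) (hvt r r')
  rw [Ne, tsub_eq_zero_iff_le, not_le]
  exact hlm

/-- Filtering and `orderEmbOfFin` both list the same index set in increasing order, and such a list
is unique. -/
theorem marks_ofFn {n : ℕ} (p : Fin n → Bool) (σ : Fin n → S) (b : Bool) {T : Finset (Fin n)}
    (hT : T = Finset.univ.filter fun k => p k = b) {d : ℕ} (h : T.card = d) :
    marks b (List.ofFn fun k => (p k, σ k)) = List.ofFn fun l => σ (T.orderEmbOfFin h l) := by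
  have h1 : (List.finRange n).filter (fun k => p k == b) = List.ofFn (T.orderEmbOfFin h) := by
    have hs1 : ((List.finRange n).filter (fun k => p k == b)).Pairwise (· < ·) :=
      (List.pairwise_lt_finRange n).filter _
    have hs2 : (List.ofFn (T.orderEmbOfFin h)).Pairwise (· < ·) := by
      rw [List.pairwise_ofFn]
      exact fun i j hij => (T.orderEmbOfFin h).strictMono hij
    refine List.Perm.eq_of_pairwise (fun a b _ _ h1 h2 => absurd h1 h2.asymm) hs1 hs2 ?_
    rw [List.perm_ext_iff_of_nodup hs1.nodup hs2.nodup]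
    intro a
    rw [List.mem_ofFn', Finset.range_orderEmbOfFin]
    simp [hT]
  rw [marks, List.ofFn_eq_map, List.filter_map, List.map_map]
  change List.map σ ((List.finRange n).filter fun k => p k == b) = _
  rw [h1, List.map_ofFn]
  rfl

theorem wordWeight_ofFn (B : S → S → ℝ≥0∞) (n : ℕ) (r : S) (p : Fin (n + 1) → Bool)
    (σ : Fin (n + 1) → S) : wordWeight B r (List.ofFn fun k => (p k, σ k)) =
      B r (σ 0) * ∏ i : Fin n, B (σ i.castSucc) (σ i.succ) := by
  induction n generalizing r with
  | zero => simp [wordWeight]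
  | succ n ih =>
    rw [List.ofFn_succ, wordWeight, ih (σ 0) (fun i => p i.succ) (fun i => σ i.succ),
      Fin.prod_univ_succ]
    rfl

end Words

/-! ### Strips as words, and a matrix criterion for the Hilbert–Schmidt property. -/

/-- The word of triangle types and spins read off a strip, starting from the root. -/
def word (x : SpinStrip) : List (Bool × ℤˣ) := List.ofFn fun k => (x.1.isUp k, x.2 k)

theorem marks_false_word (x : SpinStrip) :
    marks false (word x) = List.ofFn fun l => x.2 (x.1.down l) := marks_ofFn _ _ _ rfl rfl

theorem marks_true_word (x : SpinStrip) :
    marks true (word x) = List.ofFn fun l => x.2 (x.1.up l) := marks_ofFn _ _ _ rfl rfl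

theorem word_injective : Function.Injective
    fun x : SpinStrip => (⟨x.1.n, fun k => (x.1.isUp k, x.2 k)⟩ : Σ n, Fin n → Bool × ℤˣ) := by
  rintro ⟨⟨n, f, h1, h2⟩, σ⟩ ⟨⟨n', f', h1', h2'⟩, σ'⟩ h
  simp only [Sigma.mk.injEq] at h
  obtain ⟨rfl, h⟩ := h
  rw [heq_eq_eq, funext_iff] at h
  simp only [Prod.mk.injEq] at h
  obtain rfl : f = f' := funext fun k => (h k).1
  obtain rfl : σ = σ' := funext fun k => (h k).2
  rfl

/-- The weight of a triangle together with the bond to the preceding one. -/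
noncomputable def bondWeight (β μ : ℝ) (r s : ℤˣ) : ℝ≥0∞ :=
  ENNReal.ofReal (Real.exp (-μ + β * (((r * s : ℤˣ) : ℤ) : ℝ)))

/-- The weight of a strip with spins. -/
noncomputable def stripWeight (β μ : ℝ) (x : SpinStrip) : ℝ≥0∞ :=
  ENNReal.ofReal (Real.exp (-μ * x.1.n - β * x.inner))

/-- The squared weight of a bond between two strips. -/
noncomputable def couplingWeight (β : ℝ) (r s : ℤˣ) : ℝ≥0∞ :=
  ENNReal.ofReal (Real.exp (2 * β * (((r * s : ℤˣ) : ℤ) : ℝ)))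

theorem spin_mul_mem (r s : ℤˣ) : -1 ≤ (((r * s : ℤˣ) : ℤ) : ℝ) ∧ (((r * s : ℤˣ) : ℤ) : ℝ) ≤ 1 :=
  abs_le.1 (abs_spin_mul _).le

/-- Opening the cycle replaces the bond from the last triangle to the root by a bond from a
fictitious spin `r`. This changes the spin sum by at most two, hence the factor `exp (2β)`. -/
theorem stripWeight_le {β : ℝ} (hβ : 0 ≤ β) (μ : ℝ) (r : ℤˣ) (x : SpinStrip) :
    stripWeight β μ x ≤ ENNReal.ofReal (Real.exp (2 * β)) * wordWeight (bondWeight β μ) r (word x) := by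
  obtain ⟨⟨n, f, ⟨hn, h1⟩, h2⟩, σ⟩ := x
  obtain ⟨k, rfl⟩ := Nat.exists_eq_succ_of_ne_zero hn.ne'
  rw [stripWeight, word, wordWeight_ofFn]
  simp only [bondWeight, SpinStrip.inner, Strip.innerEnergy]
  rw [← ENNReal.ofReal_prod_of_nonneg fun _ _ => (Real.exp_pos _).le, ← Real.exp_sum,
    ← ENNReal.ofReal_mul (Real.exp_pos _).le, ← ENNReal.ofReal_mul (Real.exp_pos _).le,
    ← Real.exp_add, ← Real.exp_add]
  refine ENNReal.ofReal_le_ofReal (Real.exp_le_exp.2 ?_)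
  rw [Fin.sum_univ_castSucc]
  simp only [finRotate_apply, Fin.coeSucc_eq_succ, Fin.last_add_one]
  rw [Finset.sum_add_distrib, ← Finset.mul_sum]
  simp only [Finset.sum_const, Finset.card_univ, Fintype.card_fin, nsmul_eq_mul]
  have h3 := mul_le_mul_of_nonneg_left (spin_mul_mem (σ (Fin.last k)) (σ 0)).2 hβ
  have h4 := mul_le_mul_of_nonneg_left (spin_mul_mem r (σ 0)).1 hβ
  push_cast at *
  linarith

theorem tsum_stripWeight_le {β μ : ℝ} (hβ : 0 ≤ β) {A : ℤˣ → ℤˣ → ℝ≥0∞} {κ : ℝ≥0∞}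
    (hκ : ∀ r, 1 + ∑' s, bondWeight β μ r s * κ ≤ κ)
    (hA : ∀ r s, (∑' t, bondWeight β μ r t * A t s) + bondWeight β μ r s ≤ A r s) (b : Bool)
    (l : List ℤˣ) :
    ∑' x : SpinStrip, (if marks b (word x) = l then stripWeight β μ x else 0) ≤
      ENNReal.ofReal (Real.exp (2 * β)) * chainWeight A κ 1 l := by
  calc _ ≤ ∑' x : SpinStrip, ENNReal.ofReal (Real.exp (2 * β)) *
        (if marks b (word x) = l then wordWeight (bondWeight β μ) 1 (word x) else 0) := by
        refine ENNReal.tsum_le_tsum fun x => ?_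
        split_ifs
        · exact stripWeight_le hβ μ 1 x
        · exact zero_le
    _ ≤ ENNReal.ofReal (Real.exp (2 * β)) * ∑' k, wordSum (bondWeight β μ) b k 1 l := by
        rw [ENNReal.tsum_mul_left]
        gcongr
        simp only [wordSum]
        refine le_trans (ENNReal.tsum_comp_le_tsum_of_injective word_injective
          fun z => if marks b (List.ofFn z.2) = l then
            wordWeight (bondWeight β μ) 1 (List.ofFn z.2) else 0) (le_of_eq ?_)
        rw [ENNReal.tsum_sigma']
        congr!
    _ ≤ _ := by gcongr; exact tsum_wordSum_le hκ hA b 1 l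

/-- Squaring turns the half-weights of the two strips into full weights and doubles `β` in the bonds
between them. -/
theorem sq_transfer_le (β μ : ℝ) (x y : SpinStrip) :
    transfer β μ 0 x y ^ 2 ≤ stripWeight β μ x * stripWeight β μ y *
      pairWeight (couplingWeight β) (marks false (word x)) (marks true (word y)) := by
  rw [transfer]
  split_ifs with h
  · rw [marks_false_word, marks_true_word, pairWeight_ofFn _ h]
    simp only [stripWeight, couplingWeight, interaction, dif_pos h, Strip.interEnergy]
    rw [← ENNReal.ofReal_prod_of_nonneg fun _ _ => (Real.exp_pos _).le, ← Real.exp_sum,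
      ← ENNReal.ofReal_mul (Real.exp_pos _).le, ← ENNReal.ofReal_mul (by positivity),
      ← Real.exp_add, ← Real.exp_add, ← ENNReal.ofReal_pow (Real.exp_pos _).le,
      ← Real.exp_nat_mul]
    refine ENNReal.ofReal_le_ofReal (Real.exp_le_exp.2 (le_of_eq ?_))
    rw [← Finset.mul_sum]
    push_cast
    ring
  · simp

/-- The transfer kernel is Hilbert–Schmidt as soon as the matrix coupling two neighbouring circles
of marked triangles is subcritical. -/
theorem hsNorm_transfer_ne_top_of_chain {β μ : ℝ} (hβ : 0 ≤ β) {A : ℤˣ → ℤˣ → ℝ≥0∞}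
    {κ lm C : ℝ≥0∞} {v : ℤˣ → ℤˣ → ℝ≥0∞}
    (hκ : ∀ r, 1 + ∑' s, bondWeight β μ r s * κ ≤ κ)
    (hA : ∀ r s, (∑' t, bondWeight β μ r t * A t s) + bondWeight β μ r s ≤ A r s)
    (hv : ∀ r r', ∑' s, ∑' s', A r s * A r' s' * couplingWeight β s s' * v s s' ≤ lm * v r r')
    (hC : ∀ r r', κ ^ 2 ≤ C * v r r') (hCt : C ≠ ⊤) (hvt : ∀ r r', v r r' ≠ ⊤) (hlm : lm < 1) :
    hsNorm (transfer β μ 0) ≠ ⊤ := by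
  have hfin := tsum_pair_list_ne_top hv hC hCt hvt hlm 1 1
  set E := ENNReal.ofReal (Real.exp (2 * β)) with hE
  have hEt : E ≠ ⊤ := ENNReal.ofReal_ne_top
  refine ne_top_of_le_ne_top (ENNReal.mul_ne_top (ENNReal.mul_ne_top hEt hEt) hfin) ?_
  -- Group the strips by the list of their marked spins, the only data through which neighbouring
  -- strips interact.
  have hins : ∀ (b : Bool) (F : List ℤˣ → ℝ≥0∞), ∑' x, stripWeight β μ x * F (marks b (word x)) =
      ∑' l, F l * ∑' x, if marks b (word x) = l then stripWeight β μ x else 0 := by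
    intro b F
    simp_rw [← ENNReal.tsum_mul_left]
    rw [ENNReal.tsum_comm]
    refine tsum_congr fun x => ?_
    rw [tsum_eq_single (marks b (word x))]
    · rw [if_pos rfl, mul_comm]
    · intro l hl
      rw [if_neg hl.symm, mul_zero]
  have hle := fun b l => tsum_stripWeight_le hβ hκ hA b l
  calc hsNorm (transfer β μ 0) ≤ ∑' x, ∑' y, stripWeight β μ x * stripWeight β μ y *
        pairWeight (couplingWeight β) (marks false (word x)) (marks true (word y)) :=
        ENNReal.tsum_le_tsum fun x => ENNReal.tsum_le_tsum fun y => sq_transfer_le β μ x y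
    _ = ∑' l, (∑' l', pairWeight (couplingWeight β) l l' *
          ∑' y, if marks true (word y) = l' then stripWeight β μ y else 0) *
          ∑' x, if marks false (word x) = l then stripWeight β μ x else 0 := by
        simp_rw [mul_assoc, ENNReal.tsum_mul_left]
        rw [← hins false fun l => ∑' l', pairWeight (couplingWeight β) l l' *
          ∑' y, if marks true (word y) = l' then stripWeight β μ y else 0]
        refine tsum_congr fun x => ?_
        rw [hins true fun l' => pairWeight (couplingWeight β) (marks false (word x)) l']
    _ ≤ ∑' l, (∑' l', pairWeight (couplingWeight β) l l' * (E * chainWeight A κ 1 l')) *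
          (E * chainWeight A κ 1 l) := by
        gcongr with l l'
        · exact hle true l'
        · exact hle false l
    _ = E * E * ∑' l, ∑' l', pairWeight (couplingWeight β) l l' *
          (chainWeight A κ 1 l * chainWeight A κ 1 l') := by
        simp_rw [← ENNReal.tsum_mul_left, ← ENNReal.tsum_mul_right]
        refine tsum_congr fun l => tsum_congr fun l' => ?_
        ring

/-! ### The region `λ < 1` -/

theorem tsum_spin (f : ℤˣ → ℝ≥0∞) : ∑' s, f s = f 1 + f (-1) := by
  rw [tsum_fintype, UnitsInt.univ, Finset.sum_insert (by decide), Finset.sum_singleton]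

theorem tsum_spin_ofReal {f : ℤˣ → ℝ} (hf : ∀ s, 0 ≤ f s) :
    ∑' s, ENNReal.ofReal (f s) = ENNReal.ofReal (f 1 + f (-1)) := by
  rw [tsum_spin, ENNReal.ofReal_add (hf _) (hf _)]

/-- The sum of each row of the matrix of bond weights. -/
noncomputable def bondSum (β μ : ℝ) : ℝ := Real.exp (-μ) * (Real.exp β + Real.exp (-β))

theorem bondSum_pos (β μ : ℝ) : 0 < bondSum β μ := by unfold bondSum; positivity

/-- Up to `exp (2β)` this is `det (1 - B)` for the 2×2 matrix `B` of bond weights, factored along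
its symmetric and antisymmetric eigenvectors. -/
theorem cDen_eq (β μ : ℝ) : cDen β μ = Real.exp (2 * β) * (1 - bondSum β μ) *
    (1 - Real.exp (-μ) * (Real.exp β - Real.exp (-β))) := by
  have h1 : Real.exp β * Real.exp (-β) = 1 := by rw [← Real.exp_add]; simp
  have h2 : Real.exp (2 * β) = Real.exp β ^ 2 := by rw [← Real.exp_nat_mul]; norm_num
  have h3 : Real.exp (-2 * μ) = Real.exp (-μ) ^ 2 := by rw [← Real.exp_nat_mul]; norm_num
  have h4 : Real.exp (β - μ) = Real.exp β * Real.exp (-μ) := by rw [← Real.exp_add]; ring_nf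
  rw [cDen, bondSum, h2, h3, h4]
  set y := Real.exp β
  set w := Real.exp (-β)
  set x := Real.exp (-μ)
  linear_combination (x ^ 2 * (y * w + 1)) * h1

theorem m_eq (β μ : ℝ) :
    m β μ = Real.exp (2 * β) * (1 - bondSum β μ) + bondSum β μ := by
  have h1 : Real.exp β * Real.exp (-β) = 1 := by rw [← Real.exp_add]; simp
  have h2 : Real.exp (2 * β) = Real.exp β ^ 2 := by rw [← Real.exp_nat_mul]; norm_num
  have h3 : Real.exp (4 * β) = Real.exp β ^ 4 := by rw [← Real.exp_nat_mul]; norm_num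
  have h4 : Real.exp (-(β + μ)) = Real.exp (-β) * Real.exp (-μ) := by
    rw [← Real.exp_add]; ring_nf
  rw [m, bondSum, h2, h3, h4]
  set y := Real.exp β
  set w := Real.exp (-β)
  set x := Real.exp (-μ)
  linear_combination (-x * y ^ 3 + x * y) * h1

theorem c_mul_cDen {β μ : ℝ} (h : cDen β μ ≠ 0) : c β μ * cDen β μ = Real.exp (β - μ) :=
  div_mul_cancel₀ _ h

/-- The numbers `c * m` and `c` are the diagonal and off-diagonal entries of `(1 - B)⁻¹ B`; its row
sum is `p / (1 - p)` when the row sum of `B` is `p`. -/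
theorem c_mul_m_add_one {β μ : ℝ} (h : cDen β μ ≠ 0) :
    c β μ * (m β μ + 1) * (1 - bondSum β μ) = bondSum β μ := by
  have h2 : Real.exp (2 * β) = Real.exp β ^ 2 := by rw [← Real.exp_nat_mul]; norm_num
  have h4 : Real.exp (β - μ) = Real.exp β * Real.exp (-μ) := by rw [← Real.exp_add]; ring_nf
  refine mul_right_cancel₀ h ?_
  have hc := c_mul_cDen h
  calc c β μ * (m β μ + 1) * (1 - bondSum β μ) * cDen β μ
      = Real.exp (β - μ) * (m β μ + 1) * (1 - bondSum β μ) := by rw [← hc]; ring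
    _ = bondSum β μ * cDen β μ := by
      rw [m_eq, cDen_eq, h2, h4, bondSum, Real.exp_neg β]
      field_simp
      ring

/-- In this form `λ / c²` is visibly the larger root of `l² - 2 q l + (m² - 1)² = 0` with `q = (m² +
1) cosh 2β`. -/
theorem lam_eq (β μ : ℝ) : lam β μ = c β μ ^ 2 * ((m β μ ^ 2 + 1) * Real.cosh (2 * β) +
    √(((m β μ ^ 2 + 1) * Real.cosh (2 * β)) ^ 2 - (m β μ ^ 2 - 1) ^ 2)) := by
  have hch := Real.cosh_pos (2 * β)
  set q := (m β μ ^ 2 + 1) * Real.cosh (2 * β) with hq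
  have hq0 : 0 < q := by positivity
  have h1 : 1 - 1 / Real.cosh (2 * β) ^ 2 * ((m β μ ^ 2 - 1) ^ 2 / (m β μ ^ 2 + 1) ^ 2) =
      (q ^ 2 - (m β μ ^ 2 - 1) ^ 2) / q ^ 2 := by
    have : m β μ ^ 2 + 1 ≠ 0 := by positivity
    rw [hq]
    field_simp
  rw [lam, h1, Real.sqrt_div' _ (by positivity), Real.sqrt_sq hq0.le]
  field_simp
  rw [hq]
  ring

theorem sq_le_lam (β μ : ℝ) : (c β μ * (m β μ + 1)) ^ 2 ≤ lam β μ := by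
  have hch := Real.one_le_cosh (2 * β)
  rw [lam_eq, mul_pow]
  refine mul_le_mul_of_nonneg_left ?_ (sq_nonneg _)
  have h1 : m β μ ^ 2 + 1 ≤ (m β μ ^ 2 + 1) * Real.cosh (2 * β) :=
    le_mul_of_one_le_right (by positivity) hch
  have h2 : 2 * m β μ ≤ √(((m β μ ^ 2 + 1) * Real.cosh (2 * β)) ^ 2 - (m β μ ^ 2 - 1) ^ 2) := by
    refine Real.le_sqrt_of_sq_le ?_
    have : (m β μ ^ 2 + 1) ^ 2 ≤ ((m β μ ^ 2 + 1) * Real.cosh (2 * β)) ^ 2 := by gcongr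
    nlinarith
  nlinarith

/-- By `sq_le_lam`, `λ < 1` forces `(p / (1 - p))² < 1`, that is `p < 1/2`. No sign of `cDen` is
assumed, so regions where the resolvent series diverges are excluded automatically. -/
theorem bondSum_lt_half {β μ : ℝ} (h : cDen β μ ≠ 0) (hl : lam β μ < 1) :
    bondSum β μ < 1 / 2 := by
  have h1 := c_mul_m_add_one h
  have h2 := (sq_le_lam β μ).trans_lt hl
  have hp := bondSum_pos β μ
  by_contra hge
  push Not at hge
  have h3 : bondSum β μ ^ 2 = (c β μ * (m β μ + 1)) ^ 2 * (1 - bondSum β μ) ^ 2 := by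
    rw [← mul_pow, h1]
  have h4 : 1 - bondSum β μ ≠ 0 := fun h0 => by
    rw [h0, mul_zero] at h1
    linarith
  have h5 : (c β μ * (m β μ + 1)) ^ 2 * (1 - bondSum β μ) ^ 2 < (1 - bondSum β μ) ^ 2 :=
    mul_lt_of_lt_one_left (by positivity) h2
  nlinarith

/-- On the region where `λ` is defined and smaller than one, the transfer kernel is
Hilbert–Schmidt. -/
theorem hsNorm_transfer_ne_top_of_lam {β μ : ℝ} (hβ : 0 ≤ β) (h : cDen β μ ≠ 0)
    (hl : lam β μ < 1) : hsNorm (transfer β μ 0) ≠ ⊤ := by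
  have hp := bondSum_lt_half h hl
  have hp0 := bondSum_pos β μ
  have hcD := c_mul_cDen h
  have hden : 0 < cDen β μ := by
    rw [cDen_eq]
    have : Real.exp (-μ) * (Real.exp β - Real.exp (-β)) < bondSum β μ := by
      unfold bondSum
      gcongr
      have := Real.exp_pos (-β)
      linarith
    have h1 : 0 < 1 - bondSum β μ := by linarith
    have h2 : 0 < 1 - Real.exp (-μ) * (Real.exp β - Real.exp (-β)) := by linarith
    positivity
  have hc : 0 < c β μ := div_pos (Real.exp_pos _) hden
  have hm : 0 < m β μ := by
    rw [m_eq]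
    have h1 : 0 < 1 - bondSum β μ := by linarith
    positivity
  -- real identities for the resolvent
  have h2 : Real.exp (2 * β) = Real.exp β ^ 2 := by rw [← Real.exp_nat_mul]; norm_num
  have h4 : Real.exp (β - μ) = Real.exp β * Real.exp (-μ) := by rw [← Real.exp_add]; ring_nf
  have hres1 : Real.exp (-μ) * Real.exp β * (c β μ * m β μ) +
      Real.exp (-μ) * Real.exp (-β) * c β μ + Real.exp (-μ) * Real.exp β = c β μ * m β μ := by
    refine mul_right_cancel₀ h ?_
    have : Real.exp (β - μ) * (Real.exp (-μ) * Real.exp β * m β μ +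
      Real.exp (-μ) * Real.exp (-β)) + Real.exp (-μ) * Real.exp β * cDen β μ =
        Real.exp (β - μ) * m β μ := by
      rw [m_eq, cDen_eq, h2, h4, bondSum, Real.exp_neg β]
      field_simp
      ring
    rw [← hcD] at this
    linear_combination this
  have hres2 : Real.exp (-μ) * Real.exp β * c β μ +
      Real.exp (-μ) * Real.exp (-β) * (c β μ * m β μ) + Real.exp (-μ) * Real.exp (-β) = c β μ := by
    refine mul_right_cancel₀ h ?_
    have : Real.exp (β - μ) * (Real.exp (-μ) * Real.exp β +
      Real.exp (-μ) * Real.exp (-β) * m β μ) + Real.exp (-μ) * Real.exp (-β) * cDen β μ =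
        Real.exp (β - μ) := by
      rw [m_eq, cDen_eq, h2, h4, bondSum, Real.exp_neg β]
      field_simp
      ring
    rw [← hcD] at this
    linear_combination this
  -- the matrices
  set p := bondSum β μ with hpdef
  have hp1 : 0 < 1 - p := by linarith
  set a : ℤˣ → ℤˣ → ℝ := fun r s => if r = s then c β μ * m β μ else c β μ with ha
  have ha0 : ∀ r s, 0 ≤ a r s := fun r s => by
    simp only [ha]
    split_ifs <;> positivity
  set q := (m β μ ^ 2 + 1) * Real.cosh (2 * β) with hq
  set l := q + √(q ^ 2 - (m β μ ^ 2 - 1) ^ 2) with hldef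
  have hlam : lam β μ = c β μ ^ 2 * l := lam_eq β μ
  have hch := Real.one_le_cosh (2 * β)
  have hqge : m β μ ^ 2 + 1 ≤ q := le_mul_of_one_le_right (by positivity) hch
  have hdisc : 0 ≤ q ^ 2 - (m β μ ^ 2 - 1) ^ 2 := by nlinarith [sq_nonneg (m β μ)]
  have hlq : l ^ 2 - 2 * q * l + (m β μ ^ 2 - 1) ^ 2 = 0 := by
    have := Real.sq_sqrt hdisc
    rw [hldef]
    linear_combination this
  have hq2 : 2 * q = (m β μ ^ 2 + 1) * (Real.exp (2 * β) + Real.exp (-(2 * β))) := by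
    rw [hq, Real.cosh_eq]; ring
  have hEE : Real.exp (2 * β) * Real.exp (-(2 * β)) = 1 := by rw [← Real.exp_add]; simp
  have hlE : 0 < l - Real.exp (2 * β) * (m β μ ^ 2 + 1) := by
    have h5 : Real.exp (2 * β) * (m β μ ^ 2 + 1) - q < √(q ^ 2 - (m β μ ^ 2 - 1) ^ 2) := by
      refine Real.lt_sqrt_of_sq_lt ?_
      have : 0 < (2 * m β μ) ^ 2 := by positivity
      have h6 : q ^ 2 - (m β μ ^ 2 - 1) ^ 2 - (Real.exp (2 * β) * (m β μ ^ 2 + 1) - q) ^ 2 =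
          (2 * m β μ) ^ 2 := by
        linear_combination (Real.exp (2 * β) * (m β μ ^ 2 + 1)) * hq2 +
          (m β μ ^ 2 + 1) ^ 2 * hEE
      linarith
    rw [hldef]
    linarith
  -- By spin-flip symmetry the eigenvector depends only on whether the two spins agree, reducing the
  -- 4×4 matrix on spin pairs to a 2×2 one. The first row of its eigenvalue equation determines
  -- `(v₁, v₂)` up to scale; the second is the quadratic satisfied by `l`.
  set v₁ := Real.exp (-(2 * β)) * (2 * m β μ) with hv₁
  set v₂ := l - Real.exp (2 * β) * (m β μ ^ 2 + 1) with hv₂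
  have hv₁0 : 0 < v₁ := by positivity
  set v : ℤˣ → ℤˣ → ℝ := fun r s => if r = s then v₁ else v₂ with hv
  have hv0 : ∀ r s, 0 < v r s := fun r s => by
    simp only [hv]
    split_ifs <;> assumption
  set d : ℤˣ → ℤˣ → ℝ := fun r s => Real.exp (2 * β * (((r * s : ℤˣ) : ℤ) : ℝ)) with hd
  have hd0 : ∀ r s, 0 ≤ d r s := fun r s => (Real.exp_pos _).le
  have hb0 : ∀ r s : ℤˣ, 0 ≤ Real.exp (-μ + β * (((r * s : ℤˣ) : ℤ) : ℝ)) :=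
    fun r s => (Real.exp_pos _).le
  have hκ0 : 0 < 1 / (1 - p) := by positivity
  refine hsNorm_transfer_ne_top_of_chain hβ (A := fun r s => ENNReal.ofReal (a r s))
    (κ := ENNReal.ofReal (1 / (1 - p))) (lm := ENNReal.ofReal (lam β μ))
    (C := ENNReal.ofReal ((1 / (1 - p)) ^ 2 / v₁ + (1 / (1 - p)) ^ 2 / v₂))
    (v := fun r s => ENNReal.ofReal (v r s)) ?_ ?_ ?_ ?_ ENNReal.ofReal_ne_top
    (fun _ _ => ENNReal.ofReal_ne_top) (ENNReal.ofReal_lt_one.2 hl)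
  · intro r
    simp only [bondWeight]
    simp_rw [← ENNReal.ofReal_mul (hb0 _ _)]
    rw [tsum_spin_ofReal fun s => mul_nonneg (hb0 r s) hκ0.le, ← ENNReal.ofReal_one,
      ← ENNReal.ofReal_add zero_le_one
        (add_nonneg (mul_nonneg (hb0 r _) hκ0.le) (mul_nonneg (hb0 r _) hκ0.le))]
    refine ENNReal.ofReal_le_ofReal (le_of_eq ?_)
    have : p = Real.exp (-μ + β) + Real.exp (-μ - β) := by
      rw [hpdef, bondSum, mul_add, ← Real.exp_add, ← Real.exp_add, ← sub_eq_add_neg]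
    rcases Int.units_eq_one_or r with rfl | rfl <;> simp [← sub_eq_add_neg] <;> field_simp <;>
      linarith
  · intro r s
    simp only [bondWeight]
    simp_rw [← ENNReal.ofReal_mul (hb0 _ _)]
    rw [tsum_spin_ofReal fun t => mul_nonneg (hb0 r t) (ha0 t s), ← ENNReal.ofReal_add
      (add_nonneg (mul_nonneg (hb0 r _) (ha0 _ s)) (mul_nonneg (hb0 r _) (ha0 _ s))) (hb0 r s)]
    refine ENNReal.ofReal_le_ofReal (le_of_eq ?_)
    simp only [Real.exp_add]
    rcases Int.units_eq_one_or r with rfl | rfl <;> rcases Int.units_eq_one_or s with rfl | rfl <;>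
      simp [ha] <;> linarith
  · intro r r'
    simp only [couplingWeight]
    simp_rw [← ENNReal.ofReal_mul (ha0 _ _)]
    have e1 : ∀ s s', ENNReal.ofReal (a r s * a r' s') *
        ENNReal.ofReal (Real.exp (2 * β * (((s * s' : ℤˣ) : ℤ) : ℝ))) * ENNReal.ofReal (v s s') =
        ENNReal.ofReal (a r s * a r' s' * d s s' * v s s') := fun s s' => by
      rw [← ENNReal.ofReal_mul (mul_nonneg (ha0 _ _) (ha0 _ _)),
        ← ENNReal.ofReal_mul (mul_nonneg (mul_nonneg (ha0 _ _) (ha0 _ _)) (hd0 s s'))]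
    have e2 : ∀ s s', 0 ≤ a r s * a r' s' * d s s' * v s s' := fun s s' =>
      mul_nonneg (mul_nonneg (mul_nonneg (ha0 _ _) (ha0 _ _)) (hd0 _ _)) (hv0 _ _).le
    simp_rw [e1]
    rw [tsum_spin, tsum_spin_ofReal (e2 _), tsum_spin_ofReal (e2 _),
      ← ENNReal.ofReal_add (add_nonneg (e2 _ _) (e2 _ _)) (add_nonneg (e2 _ _) (e2 _ _)),
      ← ENNReal.ofReal_mul (by rw [hlam]; have : 0 ≤ l := by nlinarith
                               positivity)]
    refine ENNReal.ofReal_le_ofReal (le_of_eq ?_)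
    have e3 : (m β μ ^ 2 + 1) * Real.exp (2 * β) * v₁ + 2 * m β μ * Real.exp (-(2 * β)) * v₂ =
        l * v₁ := by
      rw [hv₁, hv₂]; ring
    have e4 : 2 * m β μ * Real.exp (2 * β) * v₁ + (m β μ ^ 2 + 1) * Real.exp (-(2 * β)) * v₂ =
        l * v₂ := by
      rw [hv₁, hv₂]
      linear_combination (-1 : ℝ) * hlq - l * hq2 + ((2 * m β μ) ^ 2 - (m β μ ^ 2 + 1) ^ 2) * hEE
    rw [hlam]
    rcases Int.units_eq_one_or r with rfl | rfl <;> rcases Int.units_eq_one_or r' with rfl | rfl <;>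
      simp [ha, hd, hv] <;> first
      | linear_combination (c β μ ^ 2) * e3
      | linear_combination (c β μ ^ 2) * e4
  · intro r r'
    rw [← ENNReal.ofReal_pow hκ0.le, ← ENNReal.ofReal_mul (by positivity)]
    refine ENNReal.ofReal_le_ofReal ?_
    have f1 : 0 < (1 / (1 - p)) ^ 2 / v₁ := by positivity
    have f2 : 0 < (1 / (1 - p)) ^ 2 / v₂ := by positivity
    simp only [hv]
    split_ifs
    · rw [add_mul, div_mul_cancel₀ _ hv₁0.ne']
      have := mul_pos f2 hv₁0
      linarith
    · rw [add_mul, div_mul_cancel₀ _ hlE.ne']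
      have := mul_pos f1 hlE
      linarith

/-! ### The critical curve `ψ` -/

theorem two_log_two_lt_of_lam {β μ : ℝ} (h : cDen β μ ≠ 0) (hl : lam β μ < 1) :
    2 * Real.log 2 < μ := by
  have h1 := bondSum_lt_half h hl
  have h2 : 2 ≤ Real.exp β + Real.exp (-β) := by
    have := Real.one_le_cosh β
    rw [Real.cosh_eq] at this
    linarith
  have h3 : Real.exp (-μ) < 1 / 4 := by
    unfold bondSum at h1
    nlinarith [Real.exp_pos (-μ)]
  rw [← Real.lt_log_iff_exp_lt (by norm_num), show (1 / 4 : ℝ) = (2 ^ 2)⁻¹ by norm_num,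
    Real.log_inv, Real.log_pow] at h3
  push_cast at h3
  linarith

/-- As `μ → ∞`, `c → 0` while `m` stays bounded, so `λ → 0`. Nonemptiness matters: otherwise the
real `sInf` defining `psi` would take its default value `0`. -/
theorem exists_lam_lt_one (β : ℝ) : {μ : ℝ | 0 < μ ∧ cDen β μ ≠ 0 ∧ lam β μ < 1}.Nonempty := by
  have hexp : ∀ a : ℝ, Tendsto (fun μ : ℝ => Real.exp (a - μ)) atTop (𝓝 0) := fun a =>
    Real.tendsto_exp_atBot.comp (tendsto_atBot_add_const_left _ a tendsto_neg_atTop_atBot)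
  have h2 : Tendsto (fun μ : ℝ => Real.exp (-2 * μ)) atTop (𝓝 0) := by
    have := (hexp 0).pow 2
    simp only [zero_sub, ne_eq, OfNat.ofNat_ne_zero, not_false_eq_true, zero_pow] at this
    refine this.congr fun μ => ?_
    rw [← Real.exp_nat_mul]
    congr 1
    push_cast
    ring
  have h3 : Tendsto (fun μ : ℝ => Real.exp (-(β + μ))) atTop (𝓝 0) := by
    refine (hexp (-β)).congr fun μ => ?_
    congr 1
    ring
  have hD : Tendsto (fun μ => cDen β μ) atTop (𝓝 (Real.exp (2 * β) * (1 - 0) ^ 2 - 0)) :=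
    ((tendsto_const_nhds.sub (hexp β)).pow 2 |>.const_mul _).sub h2
  have hD0 : Real.exp (2 * β) * (1 - 0) ^ 2 - 0 ≠ 0 := by
    have := Real.exp_pos (2 * β)
    norm_num
  have hc : Tendsto (fun μ => c β μ) atTop (𝓝 (0 / (Real.exp (2 * β) * (1 - 0) ^ 2 - 0))) :=
    (hexp β).div hD hD0
  have hm : Tendsto (fun μ => m β μ) atTop
      (𝓝 (Real.exp (2 * β) + (1 - Real.exp (4 * β)) * 0)) :=
    tendsto_const_nhds.add (h3.const_mul _)
  have hl : Tendsto (fun μ => lam β μ) atTop (𝓝 0) := by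
    have hA := (hm.pow 2).add_const 1 |>.mul_const (Real.cosh (2 * β))
    have := (hc.pow 2).mul (hA.add ((hA.pow 2).sub (((hm.pow 2).sub_const 1).pow 2)).sqrt)
    rw [zero_div, zero_pow two_ne_zero, zero_mul] at this
    exact this.congr fun μ => (lam_eq β μ).symm
  obtain ⟨μ, h1, h2, h3⟩ := ((eventually_gt_atTop 0).and
    ((hD.eventually_ne hD0).and (hl.eventually (gt_mem_nhds zero_lt_one)))).exists
  exact ⟨μ, h1, h2, h3⟩

theorem two_log_two_le_psi (β : ℝ) : 2 * Real.log 2 ≤ psi β :=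
  le_csInf (exists_lam_lt_one β) fun _ h => (two_log_two_lt_of_lam h.2.1 h.2.2).le

theorem transfer_anti {μ μ' : ℝ} (h : μ ≤ μ') (β γ : ℝ) (x y : SpinStrip) :
    transfer β μ' γ x y ≤ transfer β μ γ x y := by
  unfold transfer
  split_ifs
  · refine ENNReal.ofReal_le_ofReal (Real.exp_le_exp.2 ?_)
    have : (0 : ℝ) ≤ x.1.n + y.1.n := by positivity
    nlinarith
  · exact le_rfl

/-- Each branch of the minimum uses its own gauge. The set where `λ < 1` is not shown to be upward
closed; instead some `μ₀ < μ` in it is chosen and the kernel is compared, being decreasing in `μ`.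
-/
theorem exists_hsNorm_transfer_ne_top {β μ : ℝ} (hβ : 0 ≤ β) (h : f₂ β + Real.log 2 < μ) :
    ∃ γ, hsNorm (transfer β μ γ) ≠ ⊤ := by
  rw [f₂] at h
  rcases min_lt_iff.1 (lt_sub_iff_add_lt.2 h) with h | h
  · obtain ⟨μ₀, ⟨_, h1, h2⟩, h3⟩ := exists_lt_of_csInf_lt (exists_lam_lt_one β)
      (show psi β < μ by linarith)
    refine ⟨0, ne_top_of_le_ne_top (hsNorm_transfer_ne_top_of_lam hβ h1 h2) ?_⟩
    refine ENNReal.tsum_le_tsum fun x => ENNReal.tsum_le_tsum fun y => ?_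
    gcongr
    exact transfer_anti h3.le β 0 x y
  · exact ⟨β, hsNorm_transfer_ne_top hβ (by linarith)⟩

theorem exists_tendsto_freeEnergyN {β μ γ : ℝ} (h : hsNorm (transfer β μ γ) ≠ ⊤) :
    ∃ L : ℝ, Tendsto (fun n : ℕ => freeEnergyN n β μ) atTop (𝓝 (L : EReal)) ∧
      freeEnergy β μ = L := by
  obtain ⟨s, h1, h2⟩ := Strip.exists_strip 1 1 one_pos one_pos
  obtain ⟨L, -, hL⟩ := exists_freeEnergy h (x₀ := ⟨s, fun _ => 1⟩) (h2.trans h1.symm)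
  exact ⟨L, hL, hL.limUnder_eq⟩

theorem freeEnergyN_le {β μ β' μ' : ℝ} {N : ℕ}
    (h : partitionFunction N β μ ≤ partitionFunction N β' μ') :
    freeEnergyN N β μ ≤ freeEnergyN N β' μ' :=
  EReal.div_le_div_right_of_nonneg (by positivity) (ENNReal.log_monotone h)

theorem freeEnergyN_le_add {β μ μ' : ℝ} (h : μ ≤ μ') {N : ℕ} (hN : 1 ≤ N) :
    freeEnergyN N β μ' ≤ ((-(2 * (μ' - μ)) : ℝ) : EReal) + freeEnergyN N β μ := by
  have h1 := ENNReal.log_monotone (partitionFunction_le_of_le h β N)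
  rw [ENNReal.log_mul_add, ENNReal.log_ofReal_of_pos (Real.exp_pos _), Real.log_exp] at h1
  have hN0 : (N : ℝ) ≠ 0 := by positivity
  have h2 := EReal.div_le_div_right_of_nonneg (c := (N : EReal)) (by positivity) h1
  refine h2.trans (le_of_eq ?_)
  have h3 : ((-(2 * (μ' - μ)) * N : ℝ) : EReal) / (N : EReal) =
      ((-(2 * (μ' - μ)) : ℝ) : EReal) := by
    rw [show (N : EReal) = ((N : ℝ) : EReal) from rfl, ← EReal.coe_div, mul_div_cancel_right₀ _ hN0]
  rw [freeEnergyN, ← h3, EReal.div_eq_inv_mul, EReal.div_eq_inv_mul, EReal.div_eq_inv_mul,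
    show (N : EReal) = ((N : ℝ) : EReal) from rfl, ← EReal.coe_inv,
    EReal.left_distrib_of_nonneg_of_ne_top (by positivity) (EReal.coe_ne_top _)]

/-- The finite-volume gap `2 (μ' - μ)` is uniform in `N` and passes to the limit; both limits being
real numbers, it gives a strict inequality. -/
theorem strictMonoOn_neg_freeEnergy {β : ℝ} (hβ : 0 ≤ β) :
    StrictMonoOn (fun μ : ℝ => -freeEnergy β μ) (Set.Ioi (f₂ β + Real.log 2)) := by
  intro μ hμ μ' hμ' hlt
  obtain ⟨γ, hγ⟩ := exists_hsNorm_transfer_ne_top hβ hμ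
  obtain ⟨γ', hγ'⟩ := exists_hsNorm_transfer_ne_top hβ hμ'
  obtain ⟨L, hL, e⟩ := exists_tendsto_freeEnergyN hγ
  obtain ⟨L', hL', e'⟩ := exists_tendsto_freeEnergyN hγ'
  have hadd : Tendsto (fun N => ((-(2 * (μ' - μ)) : ℝ) : EReal) + freeEnergyN N β μ) atTop
      (𝓝 (((-(2 * (μ' - μ)) : ℝ) : EReal) + L)) :=
    (EReal.continuousAt_add_coe_coe _ _).tendsto.comp (tendsto_const_nhds.prodMk_nhds hL)
  have hle : (L' : EReal) ≤ ((-(2 * (μ' - μ)) : ℝ) : EReal) + L := by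
    refine le_of_tendsto_of_tendsto hL' hadd ?_
    filter_upwards [eventually_ge_atTop 1] with N hN
    exact freeEnergyN_le_add hlt.le hN
  rw [← EReal.coe_add, EReal.coe_le_coe_iff] at hle
  simp only [e, e']
  rw [EReal.neg_lt_neg_iff, EReal.coe_lt_coe_iff]
  linarith

theorem tendsto_freeEnergyN_top {β μ : ℝ} (hβ : 0 < β) (h : μ < f₁ β + Real.log 2) :
    Tendsto (fun N : ℕ => freeEnergyN N β μ) atTop (𝓝 ⊤) := by
  refine tendsto_const_nhds.congr' ?_
  filter_upwards [eventually_ge_atTop 1] with N hN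
  rw [freeEnergyN, partitionFunction_eq_top hN h hβ, ENNReal.log_top,
    show (N : EReal) = ((N : ℝ) : EReal) from rfl,
    EReal.top_div_of_pos_ne_top (by exact_mod_cast hN) (EReal.coe_ne_top _)]

/-- Once `2 sinh β < 1`, `f₁` equals `log 2`. The bound `psi β ≥ 2 log 2` keeps `log 2` inside the
interval, whose length is at most `3β/2`. -/
theorem tendsto_hausdorffEDist_I :
    Tendsto (fun β : ℝ => Metric.hausdorffEDist (I β) {Real.log 2}) (𝓝[>] 0) (𝓝 0) := by
  have hup : Tendsto (fun β : ℝ => ENNReal.ofReal (3 / 2 * β)) (𝓝[>] 0) (𝓝 0) := by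
    have : Tendsto (fun β : ℝ => 3 / 2 * β) (𝓝[>] 0) (𝓝 (3 / 2 * 0)) :=
      (tendsto_id.mono_left nhdsWithin_le_nhds).const_mul _
    rw [mul_zero] at this
    simpa using ENNReal.tendsto_ofReal this
  have hsinh : ∀ᶠ β : ℝ in 𝓝[>] 0, 2 * Real.sinh β < 1 := by
    have : Tendsto (fun β : ℝ => 2 * Real.sinh β) (𝓝[>] 0) (𝓝 (2 * Real.sinh 0)) :=
      ((Real.continuous_sinh.tendsto 0).mono_left nhdsWithin_le_nhds).const_mul _
    rw [Real.sinh_zero, mul_zero] at this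
    exact this.eventually (gt_mem_nhds one_pos)
  refine tendsto_of_tendsto_of_tendsto_of_le_of_le' tendsto_const_nhds hup
    (Eventually.of_forall fun _ => zero_le) ?_
  filter_upwards [hsinh, self_mem_nhdsWithin] with β h1 hβ
  have hβ' : 0 < β := hβ
  have hlog2 : 0 < Real.log 2 := Real.log_pos (by norm_num)
  have hf1 : f₁ β = Real.log 2 := by
    refine max_eq_left ?_
    have := Real.log_nonpos (x := 2 * Real.sinh β)
      (by have := Real.sinh_pos_iff.2 hβ'; positivity) h1.le
    linarith
  have hf2 : Real.log 2 ≤ f₂ β :=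
    le_min (by linarith [two_log_two_le_psi β]) (by linarith)
  have hf2' : f₂ β ≤ 3 / 2 * β + Real.log 2 := min_le_right _ _
  refine Metric.hausdorffEDist_le_of_mem_edist ?_ ?_
  · intro x hx
    rw [I, hf1] at hx
    refine ⟨Real.log 2, rfl, ?_⟩
    rw [edist_dist, Real.dist_eq, abs_of_nonneg (by linarith [hx.1])]
    exact ENNReal.ofReal_le_ofReal (by linarith [hx.2])
  · rintro x rfl
    exact ⟨Real.log 2, ⟨hf1.le, hf2⟩, by simp⟩

/-! ### The limit `β → 0⁺` -/

theorem summable_cdt_pow {g : ℝ} (hg0 : 0 < g) (hg : g < 1 / 2) (N : ℕ) :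
    Summable fun t : CDT N => g ^ t.size := by
  have hinj : Function.Injective (CDT.strip : CDT N → Fin N → Strip) := by
    rintro ⟨s, hs⟩ ⟨s', hs'⟩ h
    cases h
    rfl
  have h1 : ∑' s : Strip, ENNReal.ofReal (g ^ s.n) ≠ ⊤ := by
    -- Halving the fugacity compensates the `2 ^ n` spin configurations, so the bound for strips
    -- with spins also covers bare strips.
    have := tsum_spinStrip_pow_ne_top (g := g / 2) (by positivity) (by linarith)
    rw [tsum_spinStrip fun s => ENNReal.ofReal ((g / 2) ^ s.n)] at this
    convert this using 3 with s
    rw [show (2 : ℝ≥0∞) = ENNReal.ofReal 2 by simp, ← ENNReal.ofReal_pow (by norm_num),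
      ← ENNReal.ofReal_mul (by positivity), ← mul_pow]
    congr 2
    ring
  have h2 : ∑' t : CDT N, ENNReal.ofReal (g ^ t.size) ≠ ⊤ := by
    refine ne_top_of_le_ne_top (ENNReal.pow_ne_top h1 (n := N)) ?_
    rw [← tsum_prod_fin]
    refine le_trans (le_of_eq (tsum_congr fun t => ?_))
      (ENNReal.tsum_comp_le_tsum_of_injective hinj _)
    rw [← ENNReal.ofReal_prod_of_nonneg fun _ _ => pow_nonneg hg0.le _, Finset.prod_pow_eq_pow_sum]
    rfl
  have := ENNReal.summable_toReal h2
  refine this.congr fun t => ?_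
  rw [ENNReal.toReal_ofReal (by positivity)]

theorem freeEnergyN_zero_eq {μ : ℝ} (h : 2 * Real.log 2 < μ) (N : ℕ) :
    freeEnergyN N 0 μ =
      ((Real.log (∑' t : CDT N, (2 * Real.exp (-μ)) ^ t.size) / N : ℝ) : EReal) := by
  have hg0 : 0 < 2 * Real.exp (-μ) := by positivity
  have hs := summable_cdt_pow hg0 (two_mul_exp_neg_lt h) N
  obtain ⟨s, h1, h2⟩ := Strip.exists_strip 1 1 one_pos one_pos
  have hpos : 0 < ∑' t : CDT N, (2 * Real.exp (-μ)) ^ t.size :=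
    hs.tsum_pos (fun t => by positivity) ⟨fun _ => s, fun _ => h2.trans h1.symm⟩ (by positivity)
  rw [freeEnergyN, partitionFunction_zero, ← ENNReal.ofReal_tsum_of_nonneg
    (fun t => by positivity) hs, ENNReal.log_ofReal_of_pos hpos, EReal.coe_div]
  rfl

theorem tendsto_shift (μ : ℝ) : Tendsto (fun β : ℝ => μ - 3 / 2 * β) (𝓝[>] 0) (𝓝 μ) := by
  have : Tendsto (fun β : ℝ => μ - 3 / 2 * β) (𝓝[>] 0) (𝓝 (μ - 3 / 2 * 0)) :=
    ((tendsto_id.mono_left nhdsWithin_le_nhds).const_mul _).const_sub _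
  simpa using this

theorem tendsto_fugacity (μ : ℝ) :
    Tendsto (fun μ' : ℝ => 2 * Real.exp (-μ')) (𝓝 μ) (𝓝 (2 * Real.exp (-μ))) :=
  Continuous.tendsto (by fun_prop) μ

theorem continuousAt_freeEnergyN_zero {μ : ℝ} (h : 2 * Real.log 2 < μ) (N : ℕ) :
    Tendsto (fun μ' : ℝ => freeEnergyN N 0 μ') (𝓝 μ) (𝓝 (freeEnergyN N 0 μ)) := by
  rw [freeEnergyN_zero_eq h]
  have hg0 : 0 < 2 * Real.exp (-μ) := by positivity
  have hg := two_mul_exp_neg_lt h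
  obtain ⟨g₁, hg1, hg2⟩ := exists_between hg
  have hs := summable_cdt_pow hg0 hg N
  obtain ⟨s, h1, h2⟩ := Strip.exists_strip 1 1 one_pos one_pos
  have hpos : 0 < ∑' t : CDT N, (2 * Real.exp (-μ)) ^ t.size :=
    hs.tsum_pos (fun t => by positivity) ⟨fun _ => s, fun _ => h2.trans h1.symm⟩ (by positivity)
  have hsum : Tendsto (fun μ' => ∑' t : CDT N, (2 * Real.exp (-μ')) ^ t.size) (𝓝 μ)
      (𝓝 (∑' t : CDT N, (2 * Real.exp (-μ)) ^ t.size)) := by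
    refine tendsto_tsum_of_dominated_convergence (summable_cdt_pow (hg0.trans hg1) hg2 N)
      (fun t => (tendsto_fugacity μ).pow _) ?_
    filter_upwards [(tendsto_fugacity μ).eventually (gt_mem_nhds hg1)] with μ' hμ' t
    rw [Real.norm_of_nonneg (by positivity)]
    gcongr
  have hreal := (hsum.log hpos.ne').div_const (N : ℝ)
  refine ((continuous_coe_real_ereal.tendsto _).comp hreal).congr' ?_
  filter_upwards [lt_mem_nhds h] with μ' hμ'
  exact (freeEnergyN_zero_eq hμ' N).symm

/-- Squeeze between `φ_N(0, μ)` and `φ_N(0, μ - 3β/2)`, the latter continuous at `β = 0` by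
dominated convergence. -/
theorem tendsto_freeEnergyN_beta {μ : ℝ} (h : 2 * Real.log 2 < μ) (N : ℕ) :
    Tendsto (fun β : ℝ => freeEnergyN N β μ) (𝓝[>] 0) (𝓝 (freeEnergyN N 0 μ)) := by
  refine tendsto_of_tendsto_of_tendsto_of_le_of_le' tendsto_const_nhds
    ((continuousAt_freeEnergyN_zero h N).comp (tendsto_shift μ))
    (Eventually.of_forall fun β => freeEnergyN_le (partitionFunction_zero_le β μ N)) ?_
  filter_upwards [self_mem_nhdsWithin] with β hβ
  exact freeEnergyN_le (partitionFunction_le_zero (le_of_lt hβ) μ N)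

theorem tendsto_log_Lam {μ : ℝ} :
    Tendsto (fun μ' : ℝ => Real.log (Lam (μ' - Real.log 2))) (𝓝 μ)
      (𝓝 (Real.log (Lam (μ - Real.log 2)))) := by
  simp_rw [Lam_sub_log_two]
  have hg0 : 0 < 2 * Real.exp (-μ) := by positivity
  refine Tendsto.log (Tendsto.pow ?_ 2) (pow_pos (moebiusFix_pos hg0) 2).ne'
  have ht := tendsto_fugacity μ
  exact ((((ht.pow 2).const_mul 4).const_sub 1).sqrt.const_sub 1).div (ht.const_mul 2)
    (by positivity)

/-- The same squeeze with `N → ∞` taken first: for small `β` both bounds are values of `log Λ`,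
which is continuous at the relevant point. -/
theorem tendsto_freeEnergy_beta {μ : ℝ} (h : 2 * Real.log 2 < μ) :
    Tendsto (fun β : ℝ => freeEnergy β μ) (𝓝[>] 0)
      (𝓝 ((Real.log (Lam (μ - Real.log 2)) : ℝ) : EReal)) := by
  have hup : Tendsto (fun β : ℝ => ((Real.log (Lam (μ - 3 / 2 * β - Real.log 2)) : ℝ) : EReal))
      (𝓝[>] 0) (𝓝 ((Real.log (Lam (μ - Real.log 2)) : ℝ) : EReal)) :=
    (continuous_coe_real_ereal.tendsto _).comp (tendsto_log_Lam.comp (tendsto_shift μ))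
  have hbounds : ∀ᶠ β : ℝ in 𝓝[>] 0,
      ((Real.log (Lam (μ - Real.log 2)) : ℝ) : EReal) ≤ freeEnergy β μ ∧
      freeEnergy β μ ≤ ((Real.log (Lam (μ - 3 / 2 * β - Real.log 2)) : ℝ) : EReal) := by
    filter_upwards [self_mem_nhdsWithin, (tendsto_shift μ).eventually (lt_mem_nhds h)]
      with β hβ hβ2
    have hβ0 : 0 ≤ β := le_of_lt hβ
    obtain ⟨L, hL, e⟩ := exists_tendsto_freeEnergyN (hsNorm_transfer_ne_top hβ0 (μ := μ)
      (by linarith))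
    rw [e]
    exact ⟨le_of_tendsto_of_tendsto' (tendsto_freeEnergyN_zero h) hL
        fun N => freeEnergyN_le (partitionFunction_zero_le β μ N),
      le_of_tendsto_of_tendsto' hL (tendsto_freeEnergyN_zero hβ2)
        fun N => freeEnergyN_le (partitionFunction_le_zero hβ0 μ N)⟩
  exact tendsto_of_tendsto_of_tendsto_of_le_of_le' tendsto_const_nhds hup
    (hbounds.mono fun _ h => h.1) (hbounds.mono fun _ h => h.2)

end IsingCDT

/-! ### The corollary. -/

theorem corollary2 :
    -- for fixed `β > 0`: above `f₂(β) + ln 2` the free energy exists, is finite, and `-φ(β, ·)`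
    -- is increasing; below `f₁(β) + ln 2` it is infinite
    (∀ β : ℝ, 0 < β →
      ((∀ μ : ℝ, IsingCDT.f₂ β + Real.log 2 < μ →
          Tendsto (fun N : ℕ => IsingCDT.freeEnergyN N β μ) atTop
            (𝓝 (IsingCDT.freeEnergy β μ)) ∧
          IsingCDT.freeEnergy β μ ≠ ⊥ ∧ IsingCDT.freeEnergy β μ ≠ ⊤) ∧
        StrictMonoOn (fun μ : ℝ => -IsingCDT.freeEnergy β μ)
          (Set.Ioi (IsingCDT.f₂ β + Real.log 2))) ∧
      (∀ μ : ℝ, μ < IsingCDT.f₁ β + Real.log 2 →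
        Tendsto (fun N : ℕ => IsingCDT.freeEnergyN N β μ) atTop
            (𝓝 (IsingCDT.freeEnergy β μ)) ∧
          IsingCDT.freeEnergy β μ = ⊤)) ∧
    -- the interval `I(β)` shrinks to `{ln 2}` in the Hausdorff distance
    Tendsto (fun β : ℝ => Metric.hausdorffEDist (IsingCDT.I β) {Real.log 2}) (𝓝[>] 0) (𝓝 0) ∧
    -- `φ(0⁺, μ) = ln Λ(μ - ln 2)`, both as `lim_N lim_{β → 0⁺} φ_N(β, μ)` and as
    -- `lim_{β → 0⁺} φ(β, μ)`
    (∀ μ : ℝ, 2 * Real.log 2 < μ →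
      (∃ a : ℕ → EReal,
        (∀ N : ℕ, 1 ≤ N →
          Tendsto (fun β : ℝ => IsingCDT.freeEnergyN N β μ) (𝓝[>] 0) (𝓝 (a N))) ∧
        Tendsto a atTop (𝓝 ((Real.log (IsingCDT.Lam (μ - Real.log 2)) : ℝ) : EReal))) ∧
      Tendsto (fun β : ℝ => IsingCDT.freeEnergy β μ) (𝓝[>] 0)
        (𝓝 ((Real.log (IsingCDT.Lam (μ - Real.log 2)) : ℝ) : EReal))) := by
  refine ⟨fun β hβ => ⟨⟨fun μ hμ => ?_, IsingCDT.strictMonoOn_neg_freeEnergy hβ.le⟩,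
    fun μ hμ => ?_⟩, IsingCDT.tendsto_hausdorffEDist_I, fun μ hμ => ⟨⟨fun N =>
      IsingCDT.freeEnergyN N 0 μ, fun N _ => IsingCDT.tendsto_freeEnergyN_beta hμ N,
      IsingCDT.tendsto_freeEnergyN_zero hμ⟩, IsingCDT.tendsto_freeEnergy_beta hμ⟩⟩
  · obtain ⟨γ, hγ⟩ := IsingCDT.exists_hsNorm_transfer_ne_top hβ.le hμ
    obtain ⟨L, hL, e⟩ := IsingCDT.exists_tendsto_freeEnergyN hγ
    rw [e]
    exact ⟨hL, EReal.coe_ne_bot L, EReal.coe_ne_top L⟩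
  · have h := IsingCDT.tendsto_freeEnergyN_top hβ hμ
    have e : IsingCDT.freeEnergy β μ = ⊤ := h.limUnder_eq
    rw [e]
    exact ⟨h, rfl⟩
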